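/- **Conventions.** Graphs have a finite vertex set. A *partially directed graph* has no loops and at most one edge between any two vertices, either directed ($X\to Y$) or undirected ($X-Y$). Its *skeleton* is the undirected graph obtained by removing all arrowheads; the subgraph *induced* by a vertex set contains all edges between its vertices. $pa(X,\mathcal G)$ is the set of $Z$ with $Z\to X$ in $\mathcal G$, and $adj(X,\mathcal G)$ is the set of vertices joined to $X$ by an edge of $\mathcal G$. A *cycle* is a cyclic sequence of at least three distinct vertices with consecutive ones adjacent; it is *partially directed* if each of its edges is undirected or directed forward along the cycle, *directed* if all edges are directed forward, and *undirected* if all edges are undirected. A *PDAG* is a partially directed graph without directed cycles, a *DAG* is a PDAG all of whose edges are directed, and a *chain graph* is a partially directed graph in which every partially directed cycle is undirected. An undirected graph is *chordal* if every cycle of length greater than three has a chord (an edge joining two nonconsecutive vertices of it). A *v-structure* is $X\to Y\leftarrow Z$ with $X\ne Z$ not adjacent. *Markov equivalence.* In a DAG, $Y$ is a descendant of $X$ (and $X$ an ancestor of $Y$) if $X=Y$ or there is a directed path from $X$ to $Y$. A path is blocked by a set $\mathbf Z$ if one of its intermediate vertices is a non-collider that is in $\mathbf Z$, or is a collider none of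 whose descendants is in $\mathbf Z$ (an intermediate vertex is a *collider* if both path edges at it point into it). Distinct $X,Y\notin\mathbf Z$ are d-separated by $\mathbf Z$ if every path between them is blocked by $\mathbf Z$. Two DAGs on the same vertex set are *Markov equivalent* if they have the same d-separation relations. The *CPDAG* of a DAG $\mathcal G$ is the PDAG with the skeleton of $\mathcal G$ in which an edge is directed $X\to Y$ if and only if $X\to Y$ is in every DAG equivalent to $\mathcal G$. A CPDAG $\mathcal G^*$ represents the class $[\mathcal G^*]$ of all DAGs whose CPDAG it is. *Causal MPDAGs.* A *pairwise causal constraint* states of a DAG that $X$ is a parent of $Y$, that $X$ is an ancestor of $Y$, or that $X$ is not an ancestor of $Y$. For a set $\mathcal B$ of such constraints, $[\mathcal G^*,\mathcal B]$ is the set of DAGs in $[\mathcal G^*]$ that satisfy all of $\mathcal B$, and $\mathcal B$ is *consistent* with $\mathcal G^*$ if $[\mathcal G^*,\mathcal B]\neq\varnothing$. An *MPDAG* is a PDAG closed under Meek's four orientation rules, that is: (1) if $X\to Y$ and $Y-Z$, then $X,Z$ are adjacent; (2) if $X\to Y\to Z$, then not $X-Z$; (3) if $X-Z_1\to Y$ and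 $X-Z_2\to Y$ with $Z_1\ne Z_2$ not adjacent, then not $X-Y$; (4) if $X-Z_1\to Z_2\to Y$ with $X,Z_2$ adjacent and $Z_1,Y$ not adjacent, then not $X-Y$. An MPDAG $\mathcal H$ is a *causal MPDAG* if there are a CPDAG $\mathcal G^*$ and a set $\mathcal B$ of pairwise causal constraints consistent with $\mathcal G^*$ such that $\mathcal H$ has the same skeleton and v-structures as $\mathcal G^*$, and an edge is directed $X\to Y$ in $\mathcal H$ if and only if $X\to Y$ is in every DAG of $[\mathcal G^*,\mathcal B]$. *B-components.* A *B-component* of a partially directed graph $\mathcal H$ is the subgraph of $\mathcal H$ induced by a class of vertices connected to each other by paths of undirected edges (a connected component of the undirected part of $\mathcal H$); it may contain directed edges. The *chain skeleton* $\mathcal H_c$ is obtained from $\mathcal H$ by removing the arrowheads of all directed edges inside B-components. **Theorem.** A partially directed graph $\mathcal H$ is a causal MPDAG if and only if the following four conditions hold: (i) the chain skeleton $\mathcal H_c$ is a chain graph; (ii) the skeleton of each B-component of $\mathcal H$ is chordal; (iii) the vertices in the same B-component of $\mathcal H$ have the same parents in $\mathcal H_c$; (iv) for any directed edge $X\to Y$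 in any B-component $\mathcal C^b$ of $\mathcal H$, $pa(X,\mathcal H)\subseteq pa(Y,\mathcal H)\setminus\{X\}$ and $adj(Y,\mathcal C^b)\setminus\{X\}\subseteq adj(X,\mathcal C^b)$. -/

import Mathlib

/-- A partially directed graph: a vertex set with directed edges `X → Y` (`dir X Y`) and undirected
edges `X - Y` (`und X Y`), no loops, and at most one edge between two vertices. -/
@[ext]
structure PDGraph (V : Type*) where
  dir : V → V → Prop
  und : V → V → Prop
  und_symm : ∀ x y, und x y → und y x
  und_irrefl : ∀ x, ¬ und x x
  dir_asymm : ∀ x y, dir x y → ¬ dir y x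
  dir_not_und : ∀ x y, dir x y → ¬ und x y

namespace PDGraph

variable {V : Type*}

/-- The skeleton: all arrowheads are removed. -/
def skeleton (G : PDGraph V) : SimpleGraph V where
  Adj x y := G.dir x y ∨ G.dir y x ∨ G.und x y
  symm := ⟨by
    rintro x y (h | h | h)
    · exact Or.inr (Or.inl h)
    · exact Or.inl h
    · exact Or.inr (Or.inr (G.und_symm x y h))⟩
  loopless := ⟨by
    rintro x (h | h | h)
    · exact G.dir_asymm x x h h
    · exact G.dir_asymm x x h h
    · exact G.und_irrefl x h⟩

/-- The undirected subgraph: all directed edges are removed. -/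
def undirectedSubgraph (G : PDGraph V) : SimpleGraph V where
  Adj x y := G.und x y
  symm := ⟨fun x y h => G.und_symm x y h⟩
  loopless := ⟨fun x h => G.und_irrefl x h⟩

/-- The induced subgraph over a set of vertices. -/
def induce (G : PDGraph V) (S : Set V) : PDGraph S where
  dir x y := G.dir x y
  und x y := G.und x y
  und_symm x y := G.und_symm x y
  und_irrefl x := G.und_irrefl x
  dir_asymm x y := G.dir_asymm x y
  dir_not_und x y := G.dir_not_und x y

/-- The set of parents of `x`. -/
def pa (G : PDGraph V) (x : V) : Set V := {y | G.dir y x}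

/-- The set of vertices adjacent to `x`. -/
def adj (G : PDGraph V) (x : V) : Set V := {y | G.skeleton.Adj x y}

/-- The set of descendants of `x` (including `x`): the vertices reached by a directed path. -/
def de (G : PDGraph V) (x : V) : Set V := {y | Relation.ReflTransGen G.dir x y}

/-- The set of v-structures `x → y ← z`, with `x ≠ z` not adjacent. -/
def vStructures (G : PDGraph V) : Set (V × V × V) :=
  {t | G.dir t.1 t.2.1 ∧ G.dir t.2.2 t.2.1 ∧ t.1 ≠ t.2.2 ∧ ¬ G.skeleton.Adj t.1 t.2.2}

/-! ### Cycles -/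

/-- A partially directed cycle on distinct vertices `c 0, c 1, …, c (n + 2)`. The addition in
`Fin (n + 3)` is cyclic, so the edge from the last vertex back to the first one is included. -/
def IsPartiallyDirectedCycle (G : PDGraph V) {n : ℕ} (c : Fin (n + 3) → V) : Prop :=
  Function.Injective c ∧ ∀ i, G.dir (c i) (c (i + 1)) ∨ G.und (c i) (c (i + 1))

/-- A directed cycle: all edges are directed, in the direction of the cycle. -/
def IsDirectedCycle (G : PDGraph V) {n : ℕ} (c : Fin (n + 3) → V) : Prop :=
  Function.Injective c ∧ ∀ i, G.dir (c i) (c (i + 1))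

/-- A PDAG: a partially directed graph without directed cycles. -/
def IsPDAG (G : PDGraph V) : Prop :=
  ∀ (n : ℕ) (c : Fin (n + 3) → V), ¬ G.IsDirectedCycle c

/-- A DAG: all edges are directed and there is no directed cycle. -/
def IsDAG (G : PDGraph V) : Prop :=
  (∀ x y, ¬ G.und x y) ∧ G.IsPDAG

/-- A chain graph: all partially directed cycles are undirected. -/
def IsChainGraph (G : PDGraph V) : Prop :=
  ∀ (n : ℕ) (c : Fin (n + 3) → V), G.IsPartiallyDirectedCycle c → ∀ i, G.und (c i) (c (i + 1))

/-! ### Markov equivalence and CPDAGs -/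

/-- The vertex number `i + 1` of `p` is a collider on `p`. -/
def IsCollider (G : PDGraph V) {x y : V} (p : G.skeleton.Walk x y) (i : ℕ) : Prop :=
  G.dir (p.getVert i) (p.getVert (i + 1)) ∧ G.dir (p.getVert (i + 2)) (p.getVert (i + 1))

/-- The path `p` of a DAG is blocked by `Z`: some intermediate vertex of `p` is a non-collider in
`Z`, or is a collider none of whose descendants (itself included) is in `Z`. -/
def IsBlocked (G : PDGraph V) (Z : Set V) {x y : V} (p : G.skeleton.Walk x y) : Prop :=
  ∃ i, i + 2 ≤ p.length ∧
    ((¬ G.IsCollider p i ∧ p.getVert (i + 1) ∈ Z) ∨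
      (G.IsCollider p i ∧ ∀ d ∈ G.de (p.getVert (i + 1)), d ∉ Z))

/-- In the DAG `G`, the vertices `x` and `y` are d-separated by `Z`. -/
def DSep (G : PDGraph V) (x y : V) (Z : Set V) : Prop :=
  ∀ p : G.skeleton.Walk x y, p.IsPath → G.IsBlocked Z p

/-- Two DAGs are Markov equivalent if they induce the same d-separation relations. -/
def MarkovEquivalent (G G' : PDGraph V) : Prop :=
  ∀ (x y : V) (Z : Set V), x ≠ y → x ∉ Z → y ∉ Z → (G.DSep x y Z ↔ G'.DSep x y Z)

/-- `C` is the CPDAG of the DAG `G`. -/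
def IsCPDAGOf (C G : PDGraph V) : Prop :=
  C.IsPDAG ∧ C.skeleton = G.skeleton ∧
    ∀ x y, C.dir x y ↔ ∀ G' : PDGraph V, G'.IsDAG → MarkovEquivalent G G' → G'.dir x y

/-- `C` is a CPDAG. -/
def IsCPDAG (C : PDGraph V) : Prop := ∃ G : PDGraph V, G.IsDAG ∧ C.IsCPDAGOf G

/-- The Markov equivalence class represented by the CPDAG `C`: the DAGs whose CPDAG is `C`. -/
def markovClass (C : PDGraph V) : Set (PDGraph V) := {D | D.IsDAG ∧ C.IsCPDAGOf D}

end PDGraph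

/-! ### Pairwise causal constraints and restricted Markov equivalence classes -/

/-- Pairwise causal constraints with tail and head in `V`. -/
inductive PairwiseConstraint (V : Type*) where
  /-- The tail is a parent of the head. -/
  | direct (tail head : V)
  /-- The tail is an ancestor of the head. -/
  | ancestral (tail head : V)
  /-- The tail is not an ancestor of the head. -/
  | nonAncestral (tail head : V)

/-- The constraint is true for the DAG `D`. -/
def PairwiseConstraint.HoldsIn {V : Type*} (D : PDGraph V) : PairwiseConstraint V → Prop
  | .direct x y => D.dir x y
  | .ancestral x y => y ∈ D.de x
  | .nonAncestral x y => y ∉ D.de x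

namespace PDGraph

variable {V : Type*}

/-- The restricted Markov equivalence class `[C, B]`. -/
def restrictedClass (C : PDGraph V) (B : Set (PairwiseConstraint V)) : Set (PDGraph V) :=
  {D | D ∈ C.markovClass ∧ ∀ b ∈ B, b.HoldsIn D}

/-! ### MPDAGs -/

/-- `G` is closed under Meek's four rules: none of the left-hand sides occurs as an induced
subgraph. In the last rule the edge between `x` and `z₂` may be of any kind. -/
structure ClosedUnderMeek (G : PDGraph V) : Prop where
  rule1 : ∀ x y z, G.dir x y → G.und y z → G.skeleton.Adj x z
  rule2 : ∀ x y z, G.dir x y → G.dir y z → ¬ G.und x z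
  rule3 : ∀ x y z₁ z₂, G.und x z₁ → G.und x z₂ → G.dir z₁ y → G.dir z₂ y → z₁ ≠ z₂ →
    ¬ G.skeleton.Adj z₁ z₂ → ¬ G.und x y
  rule4 : ∀ x y z₁ z₂, G.und x z₁ → G.dir z₁ z₂ → G.dir z₂ y → G.skeleton.Adj x z₂ →
    ¬ G.skeleton.Adj z₁ y → ¬ G.und x y

/-- An MPDAG: a PDAG which is closed under Meek's rules. -/
def IsMPDAG (G : PDGraph V) : Prop := G.IsPDAG ∧ G.ClosedUnderMeek

/-- `H` is the MPDAG of the restricted Markov equivalence class `[C, B]`. -/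
def IsMPDAGOf (H C : PDGraph V) (B : Set (PairwiseConstraint V)) : Prop :=
  H.skeleton = C.skeleton ∧ H.vStructures = C.vStructures ∧
    ∀ x y, H.dir x y ↔ ∀ D ∈ C.restrictedClass B, D.dir x y

/-- `H` is a causal MPDAG: the MPDAG of `[C, B]` for some CPDAG `C` and some set `B` of pairwise
causal constraints that is consistent with `C`. -/
def IsCausalMPDAG (H : PDGraph V) : Prop :=
  H.IsMPDAG ∧ ∃ (C : PDGraph V) (B : Set (PairwiseConstraint V)),
    C.IsCPDAG ∧ (C.restrictedClass B).Nonempty ∧ H.IsMPDAGOf C B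

/-! ### B-components and the chain skeleton -/

/-- A B-component is given by a class of vertices that are connected by undirected paths. -/
abbrev BComponent (G : PDGraph V) : Type _ := G.undirectedSubgraph.ConnectedComponent

/-- The vertices `x` and `y` are in the same B-component. -/
def SameBComponent (G : PDGraph V) (x y : V) : Prop := G.undirectedSubgraph.Reachable x y

/-- The B-component as a graph: the induced subgraph of `G` over its vertices. -/
def BComponent.graph {G : PDGraph V} (C : G.BComponent) : PDGraph C.supp := G.induce C.supp

/-- The chain skeleton: the arrowheads of all directed edges inside B-components are removed. -/
def chainSkeleton (G : PDGraph V) : PDGraph V where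
  dir x y := G.dir x y ∧ ¬ G.SameBComponent x y
  und x y := G.und x y ∨ ((G.dir x y ∨ G.dir y x) ∧ G.SameBComponent x y)
  und_symm := by
    rintro x y (h | ⟨h, hs⟩)
    · exact Or.inl (G.und_symm x y h)
    · exact Or.inr ⟨h.symm, hs.symm⟩
  und_irrefl := by
    rintro x (h | ⟨h | h, -⟩)
    · exact G.und_irrefl x h
    · exact G.dir_asymm x x h h
    · exact G.dir_asymm x x h h
  dir_asymm := by
    rintro x y ⟨h, -⟩ ⟨h', -⟩
    exact G.dir_asymm x y h h'
  dir_not_und := by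
    rintro x y ⟨h, hs⟩ (h' | ⟨-, hs'⟩)
    · exact G.dir_not_und x y h h'
    · exact hs hs'

end PDGraph

/-- A graph is chordal if every cycle of length greater than three has a chord, that is, an edge
joining two nonconsecutive vertices of the cycle. Indices are added cyclically. -/
def SimpleGraph.IsChordalGraph {V : Type*} (G : SimpleGraph V) : Prop :=
  ∀ (n : ℕ) (c : Fin (n + 4) → V), Function.Injective c → (∀ i, G.Adj (c i) (c (i + 1))) →
    ∃ i j, j ≠ i + 1 ∧ i ≠ j + 1 ∧ G.Adj (c i) (c j)

open Relation

/-! Necessity propagates Meek's rules along undirected paths. A parent outside a B-component is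
shared by the whole component (`dir_of_und`); inside a component arrows compose and colliders are
shielded (`dir_trans`, `adj_of_collider`). So no v-structure has an arrow inside a component, and
chordality follows from any DAG of the class: it has a collider on every cycle, and the outer
vertices of this collider must be adjacent (`isChordalGraph_bComponent`).

For sufficiency, the arrows inside components form a strict partial order along which closed
neighbourhoods shrink. A chordal graph has a perfect elimination order that extends such an order
and starts with a given down-closed clique (`exists_elimination`). Orienting the components by it
gives a DAG with the skeleton, v-structures and arrows of `H` in which every undirected edge at a
prescribed vertex points away from it (`exists_extension`). Hence the direct constraints read off
from `H` force the arrows of `H` and no others.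

That all these DAGs are Markov equivalent is the Verma–Pearl criterion
(`markovEquivalent_of_skeleton_eq`): DAGs with equal skeleton and v-structures are joined by
reversals of covered edges. Rewriting d-connection as reachability of states (`not_dSep_iff`) makes
its invariance under a reversal an induction. -/

theorem Relation.ReflTransGen.exists_seq {α : Type*} {r : α → α → Prop} {x y : α}
    (h : ReflTransGen r x y) :
    ∃ (n : ℕ) (p : ℕ → α), p 0 = x ∧ p n = y ∧ ∀ i < n, r (p i) (p (i + 1)) := by
  induction h using ReflTransGen.head_induction_on with
  | refl => exact ⟨0, fun _ => y, rfl, rfl, by simp⟩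
  | @head a c hac _ ih =>
    obtain ⟨n, p, h0, hn, hp⟩ := ih
    refine ⟨n + 1, fun i => Nat.casesOn i a p, rfl, hn, ?_⟩
    rintro (_ | i) hi
    · simpa [h0] using hac
    · exact hp i (by omega)

theorem Fin.ofNat_add_one (n k : ℕ) [NeZero n] : Fin.ofNat n k + 1 = Fin.ofNat n (k + 1) := by
  ext
  simp [Fin.val_add]

theorem Fin.val_add_one_eq_ite {n : ℕ} (i : Fin (n + 1)) :
    (i + 1).1 = if i.1 = n then 0 else i.1 + 1 := by
  rw [Fin.val_add_one]
  simp [Fin.ext_iff]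

/-! ### Directed cycles, closed walks and rank functions -/

namespace PDGraph

variable {V : Type*} {G G' : PDGraph V}

/-- There is no directed closed walk. -/
def Acyclic (G : PDGraph V) : Prop := ∀ x, ¬ TransGen G.dir x x

theorem Acyclic.isPDAG (h : G.Acyclic) : G.IsPDAG := by
  rintro n c ⟨-, hc⟩
  have key : ∀ k : ℕ, TransGen G.dir (c 0) (c (Fin.ofNat (n + 3) (k + 1))) := by
    intro k
    induction k with
    | zero =>
      have := hc (Fin.ofNat (n + 3) 0)
      rw [Fin.ofNat_add_one] at this
      exact TransGen.single this
    | succ k ih =>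
      have := hc (Fin.ofNat (n + 3) (k + 1))
      rw [Fin.ofNat_add_one] at this
      exact ih.tail this
  have := key (n + 2)
  rw [show Fin.ofNat (n + 3) (n + 2 + 1) = 0 from Fin.ext (by simp)] at this
  exact h _ this

/-- A shortest closed directed walk repeats no vertex. Lengths one and two, which are not cycles,
are excluded by asymmetry. -/
theorem IsPDAG.acyclic (h : G.IsPDAG) : G.Acyclic := by
  classical
  intro x hx
  have hex : ∃ n : ℕ, 0 < n ∧ ∃ p : ℕ → V, p 0 = p n ∧ ∀ i < n, G.dir (p i) (p (i + 1)) := by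
    obtain ⟨z, hxz, hzx⟩ := TransGen.head'_iff.1 hx
    obtain ⟨n, p, h0, hn, hp⟩ := hzx.exists_seq
    refine ⟨n + 1, by omega, fun i => Nat.casesOn i x p, hn.symm, ?_⟩
    rintro (_ | i) hi
    · simpa [h0] using hxz
    · exact hp i (by omega)
  obtain ⟨hpos, p, h0, hp⟩ := Nat.find_spec hex
  have hmin := fun m => Nat.find_min hex (m := m)
  generalize Nat.find hex = n at hpos h0 hp hmin
  have hinj : ∀ i j, i < j → j < n → p i ≠ p j := by
    intro i j hij hj he
    refine hmin (j - i) (by omega) ⟨by omega, fun k => p (i + k), ?_, ?_⟩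
    · simpa [Nat.add_sub_cancel' hij.le] using he
    · intro k hk
      exact hp (i + k) (by omega)
  obtain _ | _ | _ | n := n
  · omega
  · have := hp 0 (by omega)
    rw [← h0] at this
    exact G.dir_asymm _ _ this this
  · have h1 := hp 0 (by omega)
    have h2 := hp 1 (by omega)
    rw [← h0] at h2
    exact G.dir_asymm _ _ h1 h2
  · refine h n (fun i => p i) ⟨?_, ?_⟩
    · intro i j hij
      by_contra hne
      rcases lt_or_gt_of_ne (Fin.val_ne_of_ne hne) with hlt | hlt
      · exact hinj _ _ hlt j.2 hij
      · exact hinj _ _ hlt i.2 hij.symm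
    · intro i
      have hi := hp i i.2
      rcases eq_or_ne i (Fin.last (n + 2)) with rfl | hne
      · simpa [h0] using hi
      · dsimp only
        rwa [Fin.val_add_one_of_lt (Fin.lt_last_iff_ne_last.2 hne)]

theorem Acyclic.exists_rank [Finite V] (h : G.Acyclic) :
    ∃ f : V → ℕ, ∀ a b, G.dir a b → f a < f b := by
  -- The rank counts strict ancestors.
  refine ⟨fun a => {z | TransGen G.dir z a}.ncard, fun a b hab => ?_⟩
  refine Set.ncard_lt_ncard ⟨fun z hz => hz.tail hab, fun hs => ?_⟩
  exact h a (hs (TransGen.single hab))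

theorem IsDAG.acyclic (h : G.IsDAG) : G.Acyclic := h.2.acyclic

theorem skeleton_adj {x y : V} : G.skeleton.Adj x y ↔ G.dir x y ∨ G.dir y x ∨ G.und x y := Iff.rfl

theorem dir.adj {x y : V} (h : G.dir x y) : G.skeleton.Adj x y := Or.inl h

theorem dir.adj' {x y : V} (h : G.dir x y) : G.skeleton.Adj y x := Or.inr (Or.inl h)

theorem IsDAG.dir_or_dir (h : G.IsDAG) {x y : V} (hxy : G.skeleton.Adj x y) :
    G.dir x y ∨ G.dir y x := by
  rcases hxy with h' | h' | h'
  · exact Or.inl h'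
  · exact Or.inr h'
  · exact (h.1 _ _ h').elim

end PDGraph

namespace PDGraph

variable {V : Type*} {G G' : PDGraph V} {Z : Set V} {x y : V}

/-! ### d-separation and reachability of directed states -/

/-- `v` is reached from `x` by an active walk, whose colliders lie in `Z` and whose non-colliders
do not; the flag tells whether its last edge points into `v`. -/
inductive BallReach (G : PDGraph V) (Z : Set V) (x : V) : V → Bool → Prop
  | start : BallReach G Z x x false
  | down {v w : V} {b : Bool} :
      BallReach G Z x v b → G.dir v w → v ∉ Z → BallReach G Z x w true
  | up_collider {v w : V} :
      BallReach G Z x v true → G.dir w v → v ∈ Z → BallReach G Z x w false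
  | up {v w : V} : BallReach G Z x v false → G.dir w v → v ∉ Z → BallReach G Z x w false

/-- Follow a directed path towards `Z` up to its first vertex in `Z`, turn there as at a collider,
and climb back. -/
theorem BallReach.bounce {v : V} (h : BallReach G Z x v true) (hv : v ∉ Z)
    (ha : ∃ d ∈ G.de v, d ∈ Z) : BallReach G Z x v false := by
  obtain ⟨z, hvz, hz⟩ := ha
  change ReflTransGen G.dir v z at hvz
  revert h hv
  induction hvz using ReflTransGen.head_induction_on with
  | refl => exact fun _ h => (h hz).elim
  | @head a c hac _ ih =>
    intro h ha
    have hc := h.down hac ha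
    by_cases hcZ : c ∈ Z
    · exact hc.up_collider hac hcZ
    · exact (ih hc hcZ).up hac hcZ

/-- The vertex `b` between `a` and `c` does not block a path. -/
def OpenTriple (G : PDGraph V) (Z : Set V) (a b c : V) : Prop :=
  (G.dir a b ∧ G.dir c b ∧ ∃ d ∈ G.de b, d ∈ Z) ∨ (¬ (G.dir a b ∧ G.dir c b) ∧ b ∉ Z)

/-- The vertices `p 0, …, p n` form a walk that is not blocked by `Z`. -/
def ActiveSeq (G : PDGraph V) (Z : Set V) (n : ℕ) (p : ℕ → V) : Prop :=
  (∀ i < n, G.skeleton.Adj (p i) (p (i + 1))) ∧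
    ∀ i, i + 2 ≤ n → G.OpenTriple Z (p i) (p (i + 1)) (p (i + 2))

theorem not_isBlocked_iff {p : G.skeleton.Walk x y} :
    ¬ G.IsBlocked Z p ↔
      ∀ i, i + 2 ≤ p.length →
        G.OpenTriple Z (p.getVert i) (p.getVert (i + 1)) (p.getVert (i + 2)) := by
  unfold IsBlocked OpenTriple IsCollider
  push Not
  refine forall_congr' fun i => forall_congr' fun _ => ?_
  by_cases h1 : G.dir (p.getVert i) (p.getVert (i + 1)) <;>
  by_cases h2 : G.dir (p.getVert (i + 2)) (p.getVert (i + 1)) <;> simp [h1, h2]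

theorem ActiveSeq.of_walk {p : G.skeleton.Walk x y} (h : ¬ G.IsBlocked Z p) :
    G.ActiveSeq Z p.length p.getVert :=
  ⟨fun _ hi => p.adj_getVert_succ hi, not_isBlocked_iff.1 h⟩

theorem exists_walk_of_adj_seq {K : SimpleGraph V} {n : ℕ} {p : ℕ → V}
    (h : ∀ i < n, K.Adj (p i) (p (i + 1))) :
    ∃ w : K.Walk (p 0) (p n), w.length = n ∧ ∀ i ≤ n, w.getVert i = p i := by
  induction n generalizing p with
  | zero => exact ⟨.nil, rfl, fun i hi => by simp [Nat.le_zero.1 hi]⟩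
  | succ n ih =>
    obtain ⟨w, hw, hv⟩ := ih (p := fun i => p (i + 1)) fun i hi => h (i + 1) (by omega)
    refine ⟨.cons (h 0 (by omega)) w, by simp [hw], ?_⟩
    rintro (_ | i) hi
    · simp
    · simpa using hv i (by omega)

/-- An active walk that leaves `p i` by an arrow and does not end with an arrow in the same
direction has a collider below `p i`. -/
theorem ActiveSeq.exists_de_mem {n : ℕ} {p : ℕ → V} (h : G.ActiveSeq Z n p) (hG : G.IsDAG)
    {j : ℕ} (hj : j + 1 ≤ n) (hlast : ¬ G.dir (p j) (p (j + 1))) (k : ℕ) :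
    ∀ i, i + k = j → G.dir (p i) (p (i + 1)) → ∃ d ∈ G.de (p i), d ∈ Z := by
  induction k with
  | zero =>
    rintro i rfl hi
    exact (hlast hi).elim
  | succ k ih =>
    intro i hik hi
    have : ∃ d ∈ G.de (p (i + 1)), d ∈ Z := by
      by_cases hd : G.dir (p (i + 1)) (p (i + 2))
      · exact ih (i + 1) (by omega) hd
      · have hd' := (hG.dir_or_dir (h.1 (i + 1) (by omega))).resolve_left hd
        rcases h.2 i (by omega) with h' | h'
        · exact h'.2.2
        · exact (h'.1 ⟨hi, hd'⟩).elim
    obtain ⟨d, hd, hdZ⟩ := this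
    exact ⟨d, ReflTransGen.head hi hd, hdZ⟩

/-- Cutting out a loop keeps a walk active. Only the triple at the junction is new. If it is a
non-collider, one of the two old triples there was too, so the vertex is not in `Z`. If it is a
collider while both old triples were not, the loop leaves the vertex downwards and does not return
by an arrow out of its last step, so `exists_de_mem` finds a descendant in `Z`. -/
theorem ActiveSeq.shortcut {n : ℕ} {p : ℕ → V} (h : G.ActiveSeq Z n p) (hG : G.IsDAG)
    {i j : ℕ} (hij : i < j) (hj : j ≤ n) (he : p i = p j) :
    G.ActiveSeq Z (n - (j - i)) (fun k => if k ≤ i then p k else p (k + (j - i))) := by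
  have hval : ∀ k, i ≤ k → (if k ≤ i then p k else p (k + (j - i))) = p (k + (j - i)) := by
    intro k hk
    rcases hk.eq_or_lt with rfl | hk
    · simp [he, Nat.add_sub_cancel' hij.le]
    · simp [not_le.2 hk]
  constructor
  · intro k hk
    rcases lt_or_ge k i with hki | hki
    · simpa [hki.le, Nat.succ_le_of_lt hki] using h.1 k (by omega)
    · dsimp only
      rw [hval k hki, hval (k + 1) (by omega)]
      have := h.1 (k + (j - i)) (by omega)
      rwa [show k + (j - i) + 1 = k + 1 + (j - i) by omega] at this
  · intro k hk
    dsimp only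
    rcases lt_trichotomy (k + 1) i with hki | hki | hki
    · rw [if_pos (by omega), if_pos (by omega), if_pos (by omega)]
      exact h.2 k (by omega)
    · rw [if_pos (by omega), if_pos (by omega), hval (k + 2) (by omega)]
      subst hki
      have h1 := h.2 k (by omega)
      have h2 := h.2 (j - 1) (by omega)
      rw [show j - 1 + 1 = j by omega, show j - 1 + 2 = k + 2 + (j - (k + 1)) by omega, ← he] at h2
      have hup := h.exists_de_mem hG (j := j - 1) (by omega)
      rw [show j - 1 + 1 = j by omega, ← he] at hup
      have hadj := hG.dir_or_dir (h.1 (k + 1) (by omega))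
      generalize p (k + 2 + (j - (k + 1))) = c at h2 ⊢
      by_cases hcol : G.dir (p k) (p (k + 1)) ∧ G.dir c (p (k + 1))
      · refine Or.inl ⟨hcol.1, hcol.2, ?_⟩
        rcases h1 with h1 | h1
        · exact h1.2.2
        rcases h2 with h2 | h2
        · exact h2.2.2
        refine hup (fun hd => h2.1 ⟨hd, hcol.2⟩) (j - (k + 2)) (k + 1) (by omega) ?_
        exact hadj.resolve_right fun hd => h1.1 ⟨hcol.1, hd⟩
      · refine Or.inr ⟨hcol, ?_⟩
        rcases h1 with h1 | h1
        · rcases h2 with h2 | h2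
          · exact (hcol ⟨h1.1, h2.2.1⟩).elim
          · exact h2.2
        · exact h1.2
    · rw [hval k (by omega), hval (k + 1) (by omega), hval (k + 2) (by omega)]
      have := h.2 (k + (j - i)) (by omega)
      rwa [show k + (j - i) + 1 = k + 1 + (j - i) by omega,
        show k + (j - i) + 2 = k + 2 + (j - i) by omega] at this

/-- A shortest active walk is a path, since any repetition could be cut out. -/
theorem not_dSep_of_activeSeq (hG : G.IsDAG)
    (h : ∃ (n : ℕ) (p : ℕ → V), p 0 = x ∧ p n = y ∧ G.ActiveSeq Z n p) : ¬ G.DSep x y Z := by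
  classical
  obtain ⟨p, hx, hy, hp⟩ := Nat.find_spec h
  have hmin := fun m => Nat.find_min h (m := m)
  generalize Nat.find h = n at hy hp hmin
  have hinj : ∀ i j, i < j → j ≤ n → p i ≠ p j := by
    intro i j hij hj he
    refine hmin (n - (j - i)) (by omega) ⟨_, ?_, ?_, hp.shortcut hG hij hj he⟩
    · simpa using hx
    · split_ifs with hle
      · rw [show n - (j - i) = i by omega, he, show j = n by omega, hy]
      · rw [show n - (j - i) + (j - i) = n by omega, hy]
  subst hx hy
  obtain ⟨w, hw, hv⟩ := exists_walk_of_adj_seq hp.1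
  intro hsep
  refine not_isBlocked_iff.2 ?_ (hsep w ?_)
  · intro i hi
    rw [hv i (by omega), hv (i + 1) (by omega), hv (i + 2) (by omega)]
    exact hp.2 i (by omega)
  · rw [← SimpleGraph.Walk.IsPath.getVert_injOn_iff]
    intro i hi j hj he
    simp only [Set.mem_ofPred_eq, hw] at hi hj
    rw [hv i hi, hv j hj] at he
    by_contra hne
    rcases lt_or_gt_of_ne hne with hlt | hlt
    · exact hinj _ _ hlt hj he
    · exact hinj _ _ hlt hi he.symm

theorem ActiveSeq.snoc {n : ℕ} {p : ℕ → V} {w : V} (h : G.ActiveSeq Z n p)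
    (hw : G.skeleton.Adj (p n) w)
    (ht : ∀ m, n = m + 1 → G.OpenTriple Z (p m) (p (m + 1)) w) :
    G.ActiveSeq Z (n + 1) (fun i => if i ≤ n then p i else w) := by
  constructor
  · intro i hi
    rcases (Nat.lt_succ_iff.1 hi).eq_or_lt with rfl | hi
    · simpa using hw
    · simpa [hi.le, Nat.succ_le_of_lt hi] using h.1 i hi
  · intro i hi
    dsimp only
    rcases hi.eq_or_lt with hi | hi
    · rw [if_pos (by omega), if_pos (by omega), if_neg (by omega)]
      exact ht i (by omega)
    · rw [if_pos (by omega), if_pos (by omega), if_pos (by omega)]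
      exact h.2 i (by omega)

/-- The direction of the last edge is carried along because it decides whether the next triple is a
collider. -/
theorem BallReach.exists_activeSeq {v : V} {b : Bool} (h : BallReach G Z x v b) :
    ∃ (n : ℕ) (p : ℕ → V), p 0 = x ∧ p n = v ∧ G.ActiveSeq Z n p ∧
      ∀ m, n = m + 1 → if b then G.dir (p m) (p (m + 1)) else G.dir (p (m + 1)) (p m) := by
  have step : ∀ {v w : V} {b c : Bool}, G.skeleton.Adj v w →
      (∀ a, (if b then G.dir a v else G.dir v a) → G.OpenTriple Z a v w) →
      (if c then G.dir v w else G.dir w v) →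
      (∃ (n : ℕ) (p : ℕ → V), p 0 = x ∧ p n = v ∧ G.ActiveSeq Z n p ∧
        ∀ m, n = m + 1 → if b then G.dir (p m) (p (m + 1)) else G.dir (p (m + 1)) (p m)) →
      ∃ (n : ℕ) (p : ℕ → V), p 0 = x ∧ p n = w ∧ G.ActiveSeq Z n p ∧
        ∀ m, n = m + 1 → if c then G.dir (p m) (p (m + 1)) else G.dir (p (m + 1)) (p m) := by
    rintro v w b c hvw ht hc ⟨n, p, h0, rfl, hp, hl⟩
    refine ⟨n + 1, fun i => if i ≤ n then p i else w, by simpa using h0, by simp,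
      hp.snoc hvw ?_, ?_⟩
    · rintro m rfl
      exact ht _ (hl m rfl)
    · intro m hm
      obtain rfl : n = m := by omega
      simpa using hc
  induction h with
  | start => exact ⟨0, fun _ => x, rfl, rfl, ⟨by simp, by simp⟩, by simp⟩
  | down _ hd hZ ih =>
    exact step hd.adj (fun a _ => Or.inr ⟨fun h => G.dir_asymm _ _ hd h.2, hZ⟩) (by simpa using hd) ih
  | up_collider _ hd hZ ih =>
    refine step hd.adj' (fun a ha => Or.inl ⟨by simpa using ha, hd, _, ReflTransGen.refl, hZ⟩)
      (by simpa using hd) ih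
  | up _ hd hZ ih =>
    refine step hd.adj' (fun a ha => Or.inr ⟨fun h => G.dir_asymm _ _ h.1 (by simpa using ha), hZ⟩)
      (by simpa using hd) ih

theorem ActiveSeq.ballReach {n : ℕ} {p : ℕ → V} (h : G.ActiveSeq Z n p) (hG : G.IsDAG)
    (h0 : p 0 ∉ Z) : ∀ i < n,
      (G.dir (p i) (p (i + 1)) → BallReach G Z (p 0) (p (i + 1)) true) ∧
      (G.dir (p (i + 1)) (p i) → BallReach G Z (p 0) (p (i + 1)) false) := by
  intro i
  induction i with
  | zero => exact fun _ => ⟨fun hd => .down .start hd h0, fun hd => .up .start hd h0⟩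
  | succ i ih =>
    intro hi
    obtain ⟨h1, h2⟩ := ih (by omega)
    have ht := h.2 i (by omega)
    have hadj := hG.dir_or_dir (h.1 i (by omega))
    constructor
    · intro hd
      have hZ : p (i + 1) ∉ Z := by
        rcases ht with ht | ht
        · exact (G.dir_asymm _ _ hd ht.2.1).elim
        · exact ht.2
      rcases hadj with ha | ha
      · exact (h1 ha).down hd hZ
      · exact (h2 ha).down hd hZ
    · intro hd
      rcases hadj with ha | ha
      · have hde : ∃ d ∈ G.de (p (i + 1)), d ∈ Z := by
          rcases ht with ht | ht
          · exact ht.2.2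
          · exact (ht.1 ⟨ha, hd⟩).elim
        -- A collider outside `Z` is only open through a descendant; the detour to it replaces the
        -- collider.
        by_cases hZ : p (i + 1) ∈ Z
        · exact (h1 ha).up_collider hd hZ
        · exact ((h1 ha).bounce hZ hde).up hd hZ
      · refine (h2 ha).up hd ?_
        rcases ht with ht | ht
        · exact (G.dir_asymm _ _ ha ht.1).elim
        · exact ht.2

theorem not_dSep_iff (hG : G.IsDAG) (hx : x ∉ Z) : ¬ G.DSep x y Z ↔ ∃ b, BallReach G Z x y b := by
  constructor
  · intro h
    unfold DSep at h
    push Not at h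
    obtain ⟨p, -, hp⟩ := h
    have hact := ActiveSeq.of_walk hp
    rcases hn : p.length with _ | n
    · obtain rfl := p.eq_of_length_eq_zero hn
      exact ⟨false, .start⟩
    · have := hact.ballReach hG (by simpa using hx) n (by omega)
      have hadj := hG.dir_or_dir (hact.1 n (by omega))
      have hy : p.getVert (n + 1) = y := by rw [← hn]; exact p.getVert_length
      rw [hy, p.getVert_zero] at this
      rw [hy] at hadj
      rcases hadj with ha | ha
      · exact ⟨_, this.1 ha⟩
      · exact ⟨_, this.2 ha⟩
  · rintro ⟨b, hb⟩
    obtain ⟨n, p, h0, hn, hp, -⟩ := hb.exists_activeSeq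
    exact not_dSep_of_activeSeq hG ⟨n, p, h0, hn, hp⟩

end PDGraph

namespace PDGraph

variable {V : Type*} {G G' : PDGraph V} {Z : Set V} {x y : V}

/-! ### Markov equivalent DAGs have the same skeleton and v-structures -/

theorem not_dSep_of_adj (h : G.skeleton.Adj x y) : ¬ G.DSep x y Z := by
  intro hs
  obtain ⟨i, hi, -⟩ := hs (.cons h .nil) (by simp [h.ne])
  simp at hi

/-- The local Markov property: a vertex is separated by its parents from its non-descendants. -/
theorem dSep_pa (hG : G.IsDAG) (hadj : ¬ G.skeleton.Adj x y) (hde : y ∉ G.de x) :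
    G.DSep x y (G.pa x) := by
  have hac := hG.acyclic
  have hx : x ∉ G.pa x := fun h => hac x (TransGen.single h)
  by_contra hs
  obtain ⟨b, hb⟩ := (not_dSep_iff hG hx).1 hs
  -- Given the parents of `x`, an active walk arriving against an arrow can only be at `x` or at a
  -- parent of `x`; one arriving along an arrow is at a strict descendant of `x`.
  have key : ∀ v b, BallReach G (G.pa x) x v b →
      (b = false → v = x ∨ G.dir v x) ∧ (b = true → TransGen G.dir x v) := by
    intro v b h
    induction h with
    | start => simp
    | @down v w b _ hd hZ ih =>
      refine ⟨by simp, fun _ => ?_⟩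
      cases b with
      | true => exact (ih.2 rfl).tail hd
      | false =>
        rcases ih.1 rfl with rfl | h
        · exact TransGen.single hd
        · exact (hZ h).elim
    | up_collider _ hd hZ ih => exact (hac x ((ih.2 rfl).tail hZ)).elim
    | up _ hd hZ ih =>
      refine ⟨fun _ => Or.inr ?_, by simp⟩
      rcases ih.1 rfl with rfl | h
      · exact hd
      · exact (hZ h).elim
  cases b with
  | true => exact hde ((key y true hb).2 rfl).to_reflTransGen
  | false =>
    rcases (key y false hb).1 rfl with rfl | h
    · exact hde ReflTransGen.refl
    · exact hadj h.adj'

/-- By acyclicity one of the two vertices is not a descendant of the other, so the local Markov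
property applies to it. -/
theorem exists_dSep (hG : G.IsDAG) (hne : x ≠ y) (hadj : ¬ G.skeleton.Adj x y) :
    (G.DSep x y (G.pa x)) ∨ (G.DSep y x (G.pa y)) := by
  by_cases h : y ∈ G.de x
  · refine Or.inr (dSep_pa hG (fun h' => hadj h'.symm) fun h' => ?_)
    rcases ReflTransGen.cases_head h with rfl | ⟨c, hc, hcy⟩
    · exact hne rfl
    · exact hG.acyclic x (TransGen.head' hc (hcy.trans h'))
  · exact Or.inl (dSep_pa hG hadj h)

theorem MarkovEquivalent.symm (h : MarkovEquivalent G G') : MarkovEquivalent G' G :=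
  fun x y Z hxy hx hy => (h x y Z hxy hx hy).symm

theorem MarkovEquivalent.trans {G'' : PDGraph V} (h : MarkovEquivalent G G')
    (h' : MarkovEquivalent G' G'') : MarkovEquivalent G G'' :=
  fun x y Z hxy hx hy => (h x y Z hxy hx hy).trans (h' x y Z hxy hx hy)

theorem notMem_pa_self : x ∉ G.pa x := fun h => G.dir_asymm _ _ h h

theorem MarkovEquivalent.adj (h : MarkovEquivalent G G') (hG : G.IsDAG)
    (hadj : G'.skeleton.Adj x y) : G.skeleton.Adj x y := by
  by_contra hn
  rcases exists_dSep hG hadj.ne hn with hs | hs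
  · exact not_dSep_of_adj hadj
      ((h x y _ hadj.ne notMem_pa_self fun hy => hn (dir.adj' hy)).1 hs)
  · exact not_dSep_of_adj hadj.symm
      ((h y x _ hadj.ne' notMem_pa_self fun hx => hn (dir.adj hx)).1 hs)

theorem MarkovEquivalent.skeleton_eq (h : MarkovEquivalent G G') (hG : G.IsDAG)
    (hG' : G'.IsDAG) : G.skeleton = G'.skeleton := by
  ext x y
  exact ⟨h.symm.adj hG', h.adj hG⟩

/-- A set that separates the ends of an unshielded triple contains its middle vertex unless this
is a collider. -/
theorem DSep.dir_of_notMem {b : V} (h : G.DSep x y Z) (hne : x ≠ y) (hx : G.skeleton.Adj x b)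
    (hy : G.skeleton.Adj b y) (hb : b ∉ Z) : G.dir x b ∧ G.dir y b := by
  obtain ⟨i, hi, hbl⟩ := h (.cons hx (.cons hy .nil)) (by simp [hx.ne, hy.ne, hne])
  obtain rfl : i = 0 := by simpa using hi
  rcases hbl with hbl | hbl
  · exact (hb (by simpa using hbl.2)).elim
  · simpa [IsCollider] using hbl.1

/-- The parents of one outer vertex separate it from the other and do not contain the collider `b`.
The same set separates in `G'`, where `b` must therefore be a collider as well. -/
theorem MarkovEquivalent.vStructures_subset (h : MarkovEquivalent G G') (hG : G.IsDAG)
    (hG' : G'.IsDAG) : G.vStructures ⊆ G'.vStructures := by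
  rintro ⟨x, b, y⟩ ⟨hx, hy, hne, hadj⟩
  dsimp only at hx hy hne hadj
  have hsk := h.skeleton_eq hG hG'
  have hx' : G'.skeleton.Adj x b := hsk ▸ hx.adj
  have hy' : G'.skeleton.Adj b y := hsk ▸ hy.adj'
  have : G'.dir x b ∧ G'.dir y b := by
    rcases exists_dSep hG hne hadj with hs | hs
    · exact DSep.dir_of_notMem
        ((h x y _ hne notMem_pa_self fun hy => hadj (dir.adj' hy)).1 hs) hne hx' hy'
        (G.dir_asymm _ _ hx)
    · exact (DSep.dir_of_notMem
        ((h y x _ hne.symm notMem_pa_self fun hx => hadj (dir.adj hx)).1 hs) hne.symm hy'.symm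
        hx'.symm (G.dir_asymm _ _ hy)).symm
  exact ⟨this.1, this.2, hne, hsk ▸ hadj⟩

theorem MarkovEquivalent.vStructures_eq (h : MarkovEquivalent G G') (hG : G.IsDAG)
    (hG' : G'.IsDAG) : G.vStructures = G'.vStructures :=
  (h.vStructures_subset hG hG').antisymm (h.symm.vStructures_subset hG' hG)

/-! ### DAGs with the same skeleton and v-structures are Markov equivalent -/

/-- `G'` arises from `G` by reversing `x → y`, and `x` and `y` have the same other parents. -/
structure IsCoveredReversal (G G' : PDGraph V) (x y : V) : Prop where
  dir : G.dir x y
  pa_tail : ∀ a, G.dir a x → G.dir a y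
  pa_head : ∀ a, G.dir a y → a ≠ x → G.dir a x
  dir_iff : ∀ a b, G'.dir a b ↔ (G.dir a b ∧ ¬ (a = x ∧ b = y)) ∨ (a = y ∧ b = x)

namespace IsCoveredReversal

theorem symm (h : IsCoveredReversal G G' x y) : IsCoveredReversal G' G y x := by
  have hxy : x ≠ y := h.dir.adj.ne
  have := h.dir
  have := G.dir_asymm _ _ h.dir
  have irr : ∀ a, ¬ G.dir a a := fun a h => G.dir_asymm a a h h
  have := h.pa_tail
  have := h.pa_head
  have := h.dir_iff
  constructor <;> grind

/-- Simulation of the active walks of `G` in `G'`. Away from `x` and `y` states survive; at `x` and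
`y` the alternatives are what the induction needs to continue the walk. A common parent of `x` and
`y`, which coveredness provides, lets a walk arrive at either of them. -/
theorem ballReach (h : IsCoveredReversal G G' x y) {s v : V} {b : Bool}
    (hb : BallReach G Z s v b) :
    (v ≠ x → v ≠ y → BallReach G' Z s v b) ∧
    (v = x → b = true → BallReach G' Z s x true ∧ BallReach G' Z s y true) ∧
    (v = x → b = false → BallReach G' Z s x false ∨ (y ∉ Z ∧ BallReach G' Z s y false) ∨
      (y ∈ Z ∧ BallReach G' Z s x true ∧ BallReach G' Z s y true)) ∧
    (v = y → b = true → (BallReach G' Z s x true ∧ BallReach G' Z s y true) ∨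
      (x ∉ Z ∧ BallReach G' Z s x false) ∨ (x ∉ Z ∧ y ∉ Z ∧ BallReach G' Z s y false)) ∧
    (v = y → b = false → BallReach G' Z s y false) := by
  have hxy : x ≠ y := h.dir.adj.ne
  have hyx := G.dir_asymm _ _ h.dir
  have hcov1 := h.pa_tail
  have hcov2 := h.pa_head
  have hG' := h.dir_iff
  have hyx' : G'.dir y x := (hG' y x).2 (Or.inr ⟨rfl, rfl⟩)
  have hkeep : ∀ a b, G.dir a b → (a ≠ x ∨ b ≠ y) → G'.dir a b := by grind
  have irr : ∀ a, ¬ G.dir a a := fun a h => G.dir_asymm a a h h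
  have D := fun v w b => @BallReach.down V G' Z s v w b
  have U := fun v w => @BallReach.up V G' Z s v w
  have C := fun v w => @BallReach.up_collider V G' Z s v w
  induction hb with
  | start =>
    have := @BallReach.start V G' Z s
    grind
  | @down v w b _ hd hZ ih =>
    by_cases hvx : v = x <;> by_cases hvy : v = y <;> by_cases hwx : w = x <;>
      by_cases hwy : w = y <;> cases b <;> grind
  | @up_collider v w _ hd hZ ih =>
    by_cases hvx : v = x <;> by_cases hvy : v = y <;> by_cases hwx : w = x <;>
      by_cases hwy : w = y <;> grind
  | @up v w _ hd hZ ih =>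
    by_cases hvx : v = x <;> by_cases hvy : v = y <;> by_cases hwx : w = x <;>
      by_cases hwy : w = y <;> grind

theorem exists_ballReach (h : IsCoveredReversal G G' x y) {s v : V}
    (hb : ∃ b, BallReach G Z s v b) : ∃ b, BallReach G' Z s v b := by
  obtain ⟨b, hb⟩ := hb
  have hyx' : G'.dir y x := (h.dir_iff y x).2 (Or.inr ⟨rfl, rfl⟩)
  obtain ⟨h1, h2, h3, h4, h5⟩ := h.ballReach hb
  by_cases hvx : v = x
  · subst hvx
    cases b with
    | true => exact ⟨_, (h2 rfl rfl).1⟩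
    | false =>
      rcases h3 rfl rfl with h | ⟨hy, h⟩ | ⟨-, h, -⟩
      · exact ⟨_, h⟩
      · exact ⟨_, h.down hyx' hy⟩
      · exact ⟨_, h⟩
  by_cases hvy : v = y
  · subst hvy
    cases b with
    | true =>
      rcases h4 rfl rfl with ⟨-, h⟩ | ⟨hx, h⟩ | ⟨-, -, h⟩
      · exact ⟨_, h⟩
      · exact ⟨_, h.up hyx' hx⟩
      · exact ⟨_, h⟩
    | false => exact ⟨_, h5 rfl rfl⟩
  exact ⟨b, h1 hvx hvy⟩

theorem markovEquivalent (h : IsCoveredReversal G G' x y) (hG : G.IsDAG) (hG' : G'.IsDAG) :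
    MarkovEquivalent G G' := by
  intro s t Z _ hs _
  rw [← not_iff_not, not_dSep_iff hG hs, not_dSep_iff hG' hs]
  exact ⟨h.exists_ballReach, h.symm.exists_ballReach⟩

theorem acyclic (h : IsCoveredReversal G G' x y) (hG : G.Acyclic) : G'.Acyclic := by
  set r : V → V → Prop := fun a b => G.dir a b ∧ ¬ (a = x ∧ b = y) with hr
  have hrG : ∀ {a b}, ReflTransGen r a b → ReflTransGen G.dir a b :=
    fun h => ReflTransGen.mono (fun _ _ h => h.1) _ _ h
  -- A directed walk that uses the new edge consists of old edges before its first use and after its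
  -- last. A cycle thus yields an old path from `x` to `y` other than the edge itself; its last
  -- inner vertex is a parent of `y`, hence of `x`, closing a cycle in `G`.
  have key : ∀ a b, TransGen G'.dir a b →
      TransGen r a b ∨ (ReflTransGen r a y ∧ ReflTransGen r x b) := by
    intro a b hab
    induction hab with
    | single hd =>
      rcases (h.dir_iff _ _).1 hd with hd | ⟨rfl, rfl⟩
      · exact Or.inl (.single hd)
      · exact Or.inr ⟨.refl, .refl⟩
    | tail _ hd ih =>
      rcases (h.dir_iff _ _).1 hd with hd | ⟨rfl, rfl⟩
      · exact ih.imp (fun h => h.tail hd) (fun h => ⟨h.1, h.2.tail hd⟩)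
      · exact ih.elim (fun h => Or.inr ⟨h.to_reflTransGen, .refl⟩) fun h => Or.inr ⟨h.1, .refl⟩
  intro a ha
  rcases key a a ha with hc | ⟨hay, hxa⟩
  · exact hG a (TransGen.mono (fun _ _ h => h.1) _ _ hc)
  · rcases ReflTransGen.cases_tail (hxa.trans hay) with hyx | ⟨c, hxc, hcy, hne⟩
    · exact G.dir_asymm _ _ h.dir (hyx ▸ h.dir)
    · have hcx : c ≠ x := fun hc => hne ⟨hc, rfl⟩
      exact hG x (TransGen.tail' (hrG hxc) (h.pa_head c hcy hcx))

theorem skeleton_eq (h : IsCoveredReversal G G' x y) (hG : G.IsDAG) (hG' : G'.IsDAG) :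
    G'.skeleton = G.skeleton := by
  ext a b
  have := h.dir
  have := h.dir_iff
  have := hG.1
  have := hG'.1
  rw [skeleton_adj, skeleton_adj]
  grind

theorem vStructures_subset (h : IsCoveredReversal G G' x y) (hG : G.IsDAG) (hG' : G'.IsDAG) :
    G'.vStructures ⊆ G.vStructures := by
  rintro ⟨a, b, c⟩ ⟨ha, hc, hne, hadj⟩
  dsimp only at ha hc hne hadj
  have hsk := h.skeleton_eq hG hG'
  rw [hsk] at hadj
  have key : ∀ a c, a ≠ c → ¬ G.skeleton.Adj a c → G'.dir a b → G'.dir c b → G.dir a b := by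
    intro a c hne hadj ha hc
    rcases (h.dir_iff _ _).1 ha with ha | ⟨rfl, rfl⟩
    · exact ha.1
    · rcases (h.dir_iff _ _).1 hc with hc | ⟨rfl, -⟩
      · exact (hadj (dir.adj' (h.pa_tail _ hc.1))).elim
      · exact (hne rfl).elim
  exact ⟨key a c hne hadj ha hc, key c a hne.symm (fun h => hadj h.symm) hc ha, hne, hadj⟩

theorem vStructures_eq (h : IsCoveredReversal G G' x y) (hG : G.IsDAG) (hG' : G'.IsDAG) :
    G'.vStructures = G.vStructures :=
  (h.vStructures_subset hG hG').antisymm (h.symm.vStructures_subset hG' hG)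

end IsCoveredReversal

/-- The reversal of the directed edge `x → y` of `G`. -/
def reverseEdge (G : PDGraph V) (x y : V) (h : G.dir x y) : PDGraph V where
  dir a b := (G.dir a b ∧ ¬ (a = x ∧ b = y)) ∨ (a = y ∧ b = x)
  und := G.und
  und_symm := G.und_symm
  und_irrefl := G.und_irrefl
  dir_asymm := by
    have := G.dir_asymm
    grind
  dir_not_und := by
    have := G.dir_not_und
    have := G.und_symm
    grind

/-- If a DAG differs from another DAG with the same skeleton and v-structures, then one of the
edges on which they differ is covered. -/
theorem exists_covered [Finite V] (hG : G.IsDAG) (hG' : G'.IsDAG)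
    (hsk : G.skeleton = G'.skeleton) (hv : G.vStructures = G'.vStructures)
    (hne : ∃ a b, G.dir a b ∧ G'.dir b a) :
    ∃ x y, G.dir x y ∧ G'.dir y x ∧ (∀ a, G.dir a x → G.dir a y) ∧
      ∀ a, G.dir a y → a ≠ x → G.dir a x := by
  obtain ⟨f, hf⟩ := hG.acyclic.exists_rank
  -- Here `y` is a lowest head of a disagreeing edge and `x` a highest tail of those into `y`. Edges
  -- with a lower head, or into `y` from above `x`, therefore agree, and a violation of coveredness
  -- would give a v-structure of only one graph or a cycle in `G'`.
  obtain ⟨y, ⟨w, hw⟩, hymin⟩ := Set.exists_min_image {b | ∃ a, G.dir a b ∧ G'.dir b a} f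
    (Set.toFinite _) (by obtain ⟨a, b, h⟩ := hne; exact ⟨b, a, h⟩)
  obtain ⟨x, ⟨hxy, hyx⟩, hxmax⟩ := Set.exists_max_image {a | G.dir a y ∧ G'.dir y a} f
    (Set.toFinite _) ⟨w, hw⟩
  have same : ∀ a b, G.dir a b → (f b < f y ∨ (b = y ∧ f x < f a)) → G'.dir a b := by
    intro a b hab hlt
    refine (hG'.dir_or_dir (hsk ▸ hab.adj)).resolve_right fun hba => ?_
    rcases hlt with hlt | ⟨rfl, hlt⟩
    · exact (hymin b ⟨a, hab, hba⟩).not_gt hlt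
    · exact (hxmax a ⟨hab, hba⟩).not_gt hlt
  have hvs : ∀ a b c, G.dir a b → G.dir c b → a ≠ c → ¬ G.skeleton.Adj a c → G'.dir a b :=
    fun a b c hab hcb hne hadj =>
      (show (a, b, c) ∈ G'.vStructures from hv ▸ ⟨hab, hcb, hne, hadj⟩).1
  have hvs' : ∀ a b c, G'.dir a b → G'.dir c b → a ≠ c → ¬ G.skeleton.Adj a c → G.dir a b :=
    fun a b c hab hcb hne hadj =>
      (show (a, b, c) ∈ G.vStructures from hv ▸ ⟨hab, hcb, hne, hsk ▸ hadj⟩).1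
  refine ⟨x, y, hxy, hyx, ?_, ?_⟩
  · intro z hzx
    have hzx' := same z x hzx (Or.inl (hf _ _ hxy))
    have hzy : z ≠ y := fun h => G.dir_asymm _ _ hxy (h ▸ hzx)
    by_cases hadj : G.skeleton.Adj z y
    · rcases hG.dir_or_dir hadj with h | h
      · exact h
      · exact absurd ((hf _ _ hzx).trans (hf _ _ hxy)) (hf _ _ h).not_gt
    · exact (G.dir_asymm _ _ hxy
        (hvs' y x z hyx hzx' hzy.symm fun h => hadj h.symm)).elim
  · intro z hzy hzx
    by_cases hadj : G.skeleton.Adj x z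
    · rcases hG.dir_or_dir hadj with h | h
      · have hzy' := same z y hzy (Or.inr ⟨rfl, hf _ _ h⟩)
        have hxz' := same x z h (Or.inl (hf _ _ hzy))
        exact (hG'.acyclic x (.tail (.tail (.single hxz') hzy') hyx)).elim
      · exact h
    · exact (G'.dir_asymm _ _ hyx (hvs x y z hxy hzy hzx.symm hadj)).elim

/-- DAGs with the same skeleton and v-structures are Markov equivalent. -/
theorem markovEquivalent_of_skeleton_eq [Finite V] (hG : G.IsDAG) (hG' : G'.IsDAG)
    (hsk : G.skeleton = G'.skeleton) (hv : G.vStructures = G'.vStructures) :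
    MarkovEquivalent G G' := by
  induction hn : {t : V × V | G.dir t.1 t.2 ∧ G'.dir t.2 t.1}.ncard using Nat.strong_induction_on
    generalizing G with
  | _ n ih =>
    by_cases hne : ∃ a b, G.dir a b ∧ G'.dir b a
    · obtain ⟨x, y, hxy, hyx, h1, h2⟩ := exists_covered hG hG' hsk hv hne
      have hcov : IsCoveredReversal G (G.reverseEdge x y hxy) x y :=
        ⟨hxy, h1, h2, fun _ _ => Iff.rfl⟩
      have hR : (G.reverseEdge x y hxy).IsDAG := ⟨hG.1, (hcov.acyclic hG.acyclic).isPDAG⟩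
      refine (hcov.markovEquivalent hG hR).trans (ih _ ?_ hR
        ((hcov.skeleton_eq hG hR).trans hsk) ((hcov.vStructures_eq hG hR).trans hv) rfl)
      rw [← hn]
      -- The pair `(x, y)` leaves the set of disagreements and none enters it.
      refine Set.ncard_lt_ncard ⟨?_, fun hs => ?_⟩
      · rintro ⟨a, b⟩ ⟨hab | ⟨rfl, rfl⟩, hba⟩
        · exact ⟨hab.1, hba⟩
        · exact (G'.dir_asymm _ _ hyx hba).elim
      · have hmem : (x, y) ∈ {t : V × V | G.dir t.1 t.2 ∧ G'.dir t.2 t.1} := ⟨hxy, hyx⟩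
        rcases (hs hmem).1 with h | ⟨h, -⟩
        · exact h.2 ⟨rfl, rfl⟩
        · exact hxy.adj.ne h
    · push Not at hne
      have heq : G = G' := by
        ext a b
        · refine ⟨fun h => (hG'.dir_or_dir (hsk ▸ h.adj)).resolve_right (hne a b h), fun h => ?_⟩
          exact (hG.dir_or_dir (hsk ▸ h.adj)).resolve_right fun h' => hne b a h' h
        · exact iff_of_false (hG.1 a b) (hG'.1 a b)
      subst heq
      exact fun _ _ _ _ _ _ => Iff.rfl

end PDGraph

namespace SimpleGraph

variable {V : Type*} {G : SimpleGraph V}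

/-! ### Chordal graphs -/

theorem IsChordalGraph.not_induced_cycle (hG : G.IsChordalGraph) {n : ℕ} {p : ℕ → V} {a : V}
    (hind : ∀ i j, i < j → j ≤ n + 2 → p i ≠ p j ∧ (G.Adj (p i) (p j) → j = i + 1))
    (hadj : ∀ i < n + 2, G.Adj (p i) (p (i + 1))) (hne : ∀ i ≤ n + 2, p i ≠ a)
    (ha0 : G.Adj a (p 0)) (han : G.Adj a (p (n + 2)))
    (ha : ∀ i, 0 < i → i < n + 2 → ¬ G.Adj a (p i)) : False := by
  -- The path fills the indices up to `n + 2`; `a` takes the remaining index `n + 3`.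
  set c : Fin (n + 4) → V := fun i => if i.1 ≤ n + 2 then p i else a with hc
  have hsucc : ∀ i : Fin (n + 4), (i + 1).1 = if i.1 = n + 3 then 0 else i.1 + 1 :=
    Fin.val_add_one_eq_ite
  have hlt : ∀ i j : Fin (n + 4), i.1 < j.1 →
      c i ≠ c j ∧ (G.Adj (c i) (c j) → j = i + 1 ∨ i = j + 1) := by
    intro i j hij
    have hci : c i = p i := if_pos (by omega)
    rcases Nat.lt_or_ge (n + 2) j.1 with hj | hj
    · have hcj : c j = a := if_neg (by omega)
      rw [hci, hcj]
      refine ⟨hne _ (by omega), fun h => ?_⟩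
      by_contra hcon
      push Not at hcon
      have h1 := Fin.val_ne_of_ne hcon.1
      have h2 := Fin.val_ne_of_ne hcon.2
      rw [hsucc] at h1 h2
      exact ha i (by grind) (by grind) h.symm
    · have hcj : c j = p j := if_pos hj
      rw [hci, hcj]
      refine ⟨(hind i j hij hj).1, fun h => Or.inl (Fin.ext ?_)⟩
      rw [hsucc, if_neg (by omega)]
      exact (hind i j hij hj).2 h
  have hinj : Function.Injective c := by
    intro i j hij
    by_contra hne
    rcases lt_or_gt_of_ne (Fin.val_ne_of_ne hne) with h | h
    · exact (hlt i j h).1 hij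
    · exact (hlt j i h).1 hij.symm
  have hcyc : ∀ i, G.Adj (c i) (c (i + 1)) := by
    intro i
    have := hsucc i
    rcases Nat.lt_trichotomy i.1 (n + 2) with hi | hi | hi
    · rw [if_neg (by omega)] at this
      simp only [hc]
      rw [if_pos (by omega), if_pos (by omega), this]
      exact hadj i hi
    · rw [if_neg (by omega)] at this
      simp only [hc]
      rw [if_pos (by omega), if_neg (by omega), hi]
      exact han.symm
    · rw [if_pos (by omega)] at this
      simp only [hc]
      rw [if_neg (by omega), if_pos (by omega), this]
      exact ha0
  obtain ⟨i, j, h1, h2, h3⟩ := hG n c hinj hcyc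
  rcases lt_trichotomy i.1 j.1 with h | h | h
  · exact ((hlt i j h).2 h3).elim h1 h2
  · exact h3.ne (congrArg c (Fin.ext h))
  · exact ((hlt j i h).2 h3.symm).elim h2 h1

/-- The edges of `G` between vertices of `W`. -/
def within (G : SimpleGraph V) (W : Set V) : SimpleGraph V where
  Adj u v := G.Adj u v ∧ u ∈ W ∧ v ∈ W
  symm := ⟨fun _ _ h => ⟨h.1.symm, h.2.2, h.2.1⟩⟩
  loopless := ⟨fun _ h => h.1.ne rfl⟩

theorem Walk.dist_getVert {s t : V} (p : G.Walk s t) (hp : p.length = G.dist s t) {i : ℕ}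
    (hi : i ≤ p.length) : G.dist s (p.getVert i) = i := by
  have h1 := G.dist_le (p.take i)
  have h2 := G.dist_le (p.drop i)
  have h3 := (p.take i).reachable.dist_triangle_left t
  rw [Walk.take_length] at h1
  rw [Walk.drop_length] at h2
  omega

/-- Otherwise a shortest path from `s` to `t` in `W` has length at least two and closes through `a`
to a chordless cycle: the distance from `s` changes by at most one along an edge. -/
theorem IsChordalGraph.adj_of_reachable_within (hG : G.IsChordalGraph) {s t a : V} {W : Set V}
    (hs : G.Adj a s) (ht : G.Adj a t) (hst : s ≠ t)
    (hW : ∀ w ∈ W, w = s ∨ w = t ∨ (w ≠ a ∧ ¬ G.Adj a w)) (hsW : s ∈ W)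
    (h : (G.within W).Reachable s t) : G.Adj s t := by
  by_contra hadj
  obtain ⟨p, hp⟩ := h.exists_walk_length_eq_dist
  have hlen := h.one_lt_dist_of_ne_of_not_adj hst fun h' => hadj h'.1
  obtain ⟨n, hn⟩ : ∃ n, p.length = n + 2 := ⟨p.length - 2, by omega⟩
  have hd := fun i (hi : i ≤ n + 2) => p.dist_getVert hp (i := i) (by omega)
  have hA : ∀ i < n + 2, (G.within W).Adj (p.getVert i) (p.getVert (i + 1)) :=
    fun i hi => p.adj_getVert_succ (by omega)
  have hmem : ∀ i ≤ n + 2, p.getVert i ∈ W := by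
    intro i hi
    rcases i with _ | i
    · simpa using hsW
    · exact (hA i (by omega)).2.2
  have hend : p.getVert (n + 2) = t := by rw [← hn]; exact p.getVert_length
  have hinj : ∀ i j, i ≤ n + 2 → j ≤ n + 2 → p.getVert i = p.getVert j → i = j := by
    intro i j hi hj he
    rw [← hd i hi, ← hd j hj, he]
  have hint : ∀ i, 0 < i → i < n + 2 → p.getVert i ≠ a ∧ ¬ G.Adj a (p.getVert i) := by
    intro i h0 hi
    rcases hW _ (hmem i hi.le) with h' | h' | h'
    · exact absurd (hinj i 0 hi.le (by omega) (by simpa using h')) (by omega)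
    · exact absurd (hinj i (n + 2) hi.le le_rfl (by rw [h', hend])) (by omega)
    · exact h'
  refine hG.not_induced_cycle (n := n) (p := p.getVert) (a := a) ?_ (fun i hi => (hA i hi).1) ?_
    (by simpa using hs) (by rwa [hend]) fun i h0 hi => (hint i h0 hi).2
  · intro i j hij hj
    refine ⟨fun he => hij.ne (hinj i j (by omega) hj he), fun hadj' => ?_⟩
    have hK : (G.within W).Adj (p.getVert i) (p.getVert j) :=
      ⟨hadj', hmem i (by omega), hmem j hj⟩
    have := hK.diff_dist_adj (u := s)
    rw [hd i (by omega), hd j hj] at this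
    omega
  · intro i hi
    rcases Nat.eq_zero_or_pos i with rfl | h0
    · simpa using hs.ne'
    · rcases hi.eq_or_lt with rfl | hi
      · rw [hend]
        exact ht.ne'
      · exact (hint i h0 hi).1

/-- The neighbours of `v` in `S` form a clique. -/
def IsSimplicialIn (G : SimpleGraph V) (S : Finset V) (v : V) : Prop :=
  ∀ x ∈ S, ∀ y ∈ S, G.Adj v x → G.Adj v y → x ≠ y → G.Adj x y

/-- A clique that is not all of a set of vertices of a chordal graph misses a simplicial vertex of
this set. -/
theorem IsChordalGraph.exists_simplicial (hG : G.IsChordalGraph) (S Q : Finset V) (hQS : Q ⊆ S)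
    (hQ : G.IsClique Q) (hne : Q ≠ S) : ∃ v ∈ S, v ∉ Q ∧ G.IsSimplicialIn S v := by
  classical
  induction hn : S.card using Nat.strong_induction_on generalizing S Q with
  | _ n ih =>
    -- Dirac's argument. Let `C` be the component of `b` among the non-neighbours of `a`, and `N`
    -- its boundary in `S`. All of `N` is adjacent to `a` and joined through `C`, so `N` is a
    -- clique. Induction on `C ∪ N` gives a simplicial vertex in `C`, whose neighbours in `S` all
    -- lie in `C ∪ N`.
    have core : ∀ a ∈ S, ∀ b ∈ S, b ≠ a → ¬ G.Adj a b →
        ∃ v ∈ S, v ≠ a ∧ ¬ G.Adj a v ∧ G.IsSimplicialIn S v := by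
      intro a ha b hb hba hab
      set T : Set V := {w | w ∈ S ∧ w ≠ a ∧ ¬ G.Adj a w} with hT
      set C : Finset V := S.filter fun w => w ∈ T ∧ (G.within T).Reachable b w with hC
      have hCT : ∀ w, w ∈ C ↔ w ∈ T ∧ (G.within T).Reachable b w := by
        intro w
        simp only [hC, Finset.mem_filter]
        exact ⟨fun h => h.2, fun h => ⟨h.1.1, h⟩⟩
      set N : Finset V := S.filter fun s => s ∉ C ∧ ∃ c ∈ C, G.Adj s c with hN
      have hNmem : ∀ s, s ∈ N ↔ s ∈ S ∧ s ∉ C ∧ ∃ c ∈ C, G.Adj s c := by simp [hN]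
      have hbC : b ∈ C := (hCT b).2 ⟨⟨hb, hba, hab⟩, .refl _⟩
      have haN : ∀ s ∈ N, G.Adj a s := by
        intro s hs
        obtain ⟨hsS, hsC, c, hc, hsc⟩ := (hNmem s).1 hs
        by_contra has
        obtain ⟨hcT, hbc⟩ := (hCT c).1 hc
        have hsT : s ∈ T := ⟨hsS, fun h => hcT.2.2 (h ▸ hsc), has⟩
        exact hsC ((hCT s).2 ⟨hsT, hbc.trans (Adj.reachable ⟨hsc.symm, hcT, hsT⟩)⟩)
      have hNclique : G.IsClique N := by
        intro s hs t ht hst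
        obtain ⟨-, -, c, hc, hsc⟩ := (hNmem s).1 hs
        obtain ⟨-, -, d, hd, htd⟩ := (hNmem t).1 ht
        set W : Set V := {w | w ∈ C ∨ w = s ∨ w = t} with hW
        have hconn : ∀ w ∈ C, (G.within W).Reachable b w := by
          intro w hw
          have hr := ((hCT w).1 hw).2
          rw [reachable_iff_reflTransGen] at hr
          clear hw
          induction hr with
          | refl => exact .refl _
          | @tail u w hu huw ih' =>
            rw [← reachable_iff_reflTransGen] at hu
            have huC : u ∈ C := (hCT u).2 ⟨huw.2.1, hu⟩
            have hwC : w ∈ C := (hCT w).2 ⟨huw.2.2, hu.trans huw.reachable⟩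
            exact ih'.trans (Adj.reachable ⟨huw.1, Or.inl huC, Or.inl hwC⟩)
        have hsW : s ∈ W := Or.inr (Or.inl rfl)
        have htW : t ∈ W := Or.inr (Or.inr rfl)
        have h1 : (G.within W).Adj s c := ⟨hsc, hsW, Or.inl hc⟩
        have h2 : (G.within W).Adj t d := ⟨htd, htW, Or.inl hd⟩
        refine hG.adj_of_reachable_within (haN s hs) (haN t ht) hst ?_ hsW
          (h1.reachable.trans (((hconn c hc).symm.trans (hconn d hd)).trans h2.reachable.symm))
        rintro w (hw | hw | hw)
        · exact Or.inr (Or.inr ((hCT w).1 hw).1.2)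
        · exact Or.inl hw
        · exact Or.inr (Or.inl hw)
      have hsub : C ∪ N ⊆ S := Finset.union_subset (Finset.filter_subset _ _)
        (Finset.filter_subset _ _)
      have haCN : a ∉ C ∪ N := by
        rw [Finset.mem_union]
        rintro (h | h)
        · exact ((hCT a).1 h).1.2.1 rfl
        · exact (haN a h).ne rfl
      have hcard : (C ∪ N).card < n := by
        rw [← hn]
        exact Finset.card_lt_card ⟨hsub, fun h => haCN (h ha)⟩
      have hbN : b ∉ N := fun h => ((hNmem b).1 h).2.1 hbC
      obtain ⟨v, hv, hvN, hsim⟩ := ih _ hcard (C ∪ N) N Finset.subset_union_right hNclique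
        (fun h => hbN (h ▸ Finset.mem_union_left _ hbC)) rfl
      have hvC : v ∈ C := (Finset.mem_union.1 hv).resolve_right hvN
      obtain ⟨hvT, -⟩ := (hCT v).1 hvC
      have hnb : ∀ x ∈ S, G.Adj v x → x ∈ C ∪ N := by
        intro x hx hvx
        by_cases hxC : x ∈ C
        · exact Finset.mem_union_left _ hxC
        · exact Finset.mem_union_right _ ((hNmem x).2 ⟨hx, hxC, v, hvC, hvx.symm⟩)
      exact ⟨v, hvT.1, hvT.2.1, hvT.2.2, fun x hx y hy hvx hvy =>
        hsim x (hnb x hx hvx) y (hnb y hy hvy) hvx hvy⟩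
    obtain ⟨u, huS, huQ⟩ : ∃ u ∈ S, u ∉ Q := by
      by_contra! hcon
      exact hne (hQS.antisymm hcon)
    -- A vertex not adjacent to some `q ∈ Q` is outside the clique `Q`. If `Q` is adjacent to
    -- everything, a vertex with any non-neighbour is outside `Q`.
    by_cases h1 : ∃ q ∈ Q, ∃ b ∈ S, b ≠ q ∧ ¬ G.Adj q b
    · obtain ⟨q, hq, b, hb, hbq, hqb⟩ := h1
      obtain ⟨v, hv, hvq, hqv, hsim⟩ := core q (hQS hq) b hb hbq hqb
      exact ⟨v, hv, fun hvQ => hqv (hQ hq hvQ hvq.symm), hsim⟩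
    · push Not at h1
      by_cases h2 : ∃ a ∈ S, ∃ b ∈ S, b ≠ a ∧ ¬ G.Adj a b
      · obtain ⟨a, ha, b, hb, hba, hab⟩ := h2
        obtain ⟨v, hv, hva, hav, hsim⟩ := core a ha b hb hba hab
        exact ⟨v, hv, fun hvQ => hav (h1 v hvQ a ha hva.symm).symm, hsim⟩
      · push Not at h2
        exact ⟨u, huS, huQ, fun x hx y hy _ _ hxy => h2 x hx y hy hxy.symm⟩

/-- A chordal graph has a perfect elimination order that is compatible with a given order `R` for
which closed neighbourhoods are decreasing, and in which a given `R`-closed clique comes first. -/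
theorem IsChordalGraph.exists_elimination (hG : G.IsChordalGraph) {R : V → V → Prop}
    (hirr : ∀ x, ¬ R x x) (htrans : ∀ x y z, R x y → R y z → R x z)
    (hR : ∀ x y, R x y → G.Adj x y ∧ ∀ z, z ≠ x → G.Adj y z → G.Adj x z)
    (S Q : Finset V) (hQS : Q ⊆ S) (hQ : G.IsClique Q)
    (hdown : ∀ q ∈ Q, ∀ v ∈ S, R v q → v ∈ Q) :
    ∃ f : V → ℕ, (∀ x ∈ S, ∀ y ∈ S, f x = f y → x = y) ∧
      (∀ x ∈ S, ∀ y ∈ S, R x y → f x < f y) ∧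
      (∀ v ∈ S, ∀ x ∈ S, ∀ y ∈ S, f x < f v → f y < f v → G.Adj v x → G.Adj v y → x ≠ y →
        G.Adj x y) ∧
      ∀ q ∈ Q, ∀ v ∈ S, v ∉ Q → f q < f v := by
  classical
  induction hn : S.card generalizing S Q with
  | zero =>
    obtain rfl := Finset.card_eq_zero.1 hn
    exact ⟨fun _ => 0, by simp⟩
  | succ n ih =>
    -- If `Q = S`, nothing outside `Q` can be placed last, but the last claim is vacuous and the
    -- empty clique serves instead.
    obtain ⟨Q', hQS', hQc', hdown', hne', hQQ'⟩ : ∃ Q' ⊆ S, G.IsClique Q' ∧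
        (∀ q ∈ Q', ∀ v ∈ S, R v q → v ∈ Q') ∧ Q' ≠ S ∧ (Q = S ∨ Q' = Q) := by
      by_cases h : Q = S
      · refine ⟨∅, by simp, by simp, by simp, ?_, Or.inl h⟩
        rintro rfl
        simp at hn
      · exact ⟨Q, hQS, hQ, hdown, h, Or.inr rfl⟩
    obtain ⟨v, hv, hvQ, hvs⟩ := hG.exists_simplicial S Q' hQS' hQc' hne'
    -- With fewest `R`-successors, `w` has none: a successor `z` would have a smaller closed
    -- neighbourhood, so it would be simplicial, outside `Q'`, and have fewer successors. So `w` can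
    -- come last.
    obtain ⟨w, hw, hwmin⟩ := Finset.exists_min_image
      (S.filter fun v => v ∉ Q' ∧ G.IsSimplicialIn S v) (fun v => (S.filter (R v)).card)
      ⟨v, Finset.mem_filter.2 ⟨hv, hvQ, hvs⟩⟩
    obtain ⟨hwS, hwQ, hws⟩ := Finset.mem_filter.1 hw
    have hwmax : ∀ z ∈ S, ¬ R w z := by
      intro z hz hwz
      have hnb : ∀ x, G.Adj z x → x = w ∨ G.Adj w x := fun x hzx =>
        or_iff_not_imp_left.2 fun h => (hR w z hwz).2 x h hzx
      refine (hwmin z (Finset.mem_filter.2 ⟨hz, fun h => hwQ (hdown' z h w hwS hwz), ?_⟩)).not_gt ?_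
      · intro x hx y hy hzx hzy hxy
        rcases hnb x hzx with rfl | hx'
        · exact (hnb y hzy).resolve_left hxy.symm
        · rcases hnb y hzy with rfl | hy'
          · exact hx'.symm
          · exact hws x hx y hy hx' hy' hxy
      · refine Finset.card_lt_card ⟨fun u hu => ?_, fun hsub => ?_⟩
        · obtain ⟨huS, hu⟩ := Finset.mem_filter.1 hu
          exact Finset.mem_filter.2 ⟨huS, htrans _ _ _ hwz hu⟩
        · exact hirr z (Finset.mem_filter.1 (hsub (Finset.mem_filter.2 ⟨hz, hwz⟩))).2
    obtain ⟨f, hf1, hf2, hf3, hf4⟩ := ih (S.erase w) (Q'.erase w)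
      (Finset.erase_subset_erase _ hQS') (hQc'.subset (by simp))
      (fun q hq v hv hvq => Finset.mem_erase.2 ⟨(Finset.mem_erase.1 hv).1,
        hdown' q (Finset.mem_of_mem_erase hq) v (Finset.mem_of_mem_erase hv) hvq⟩)
      (by rw [Finset.card_erase_of_mem hwS, hn]; rfl)
    rw [Finset.erase_eq_of_notMem hwQ] at hf4
    have hlt : ∀ x ∈ S, x ≠ w → Function.update f w (S.sup f + 1) x = f x ∧
        f x < Function.update f w (S.sup f + 1) w := by
      intro x hx hxw
      rw [Function.update_of_ne hxw, Function.update_self]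
      exact ⟨rfl, Nat.lt_succ_of_le (Finset.le_sup hx)⟩
    refine ⟨Function.update f w (S.sup f + 1), ?_, ?_, ?_, ?_⟩ <;>
      generalize Function.update f w (S.sup f + 1) = g at hlt
    · intro x hx y hy hxy
      have := hf1 x
      grind
    · intro x hx y hy hxy
      have := hf2 x
      grind
    · intro v hv x hx y hy hxv hyv hvx hvy hxy
      by_cases hvw : v = w
      · subst hvw
        exact hws x hx y hy hvx hvy hxy
      · have := hf3 v
        grind
    · intro q hq v hv hvQ
      have := hf4 q
      grind

end SimpleGraph

namespace PDGraph

variable {V : Type*} {H : PDGraph V} {x y z : V}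

/-! ### B-components of MPDAGs -/

theorem SameBComponent.refl (x : V) : H.SameBComponent x x := SimpleGraph.Reachable.refl x

theorem SameBComponent.symm (h : H.SameBComponent x y) : H.SameBComponent y x :=
  SimpleGraph.Reachable.symm h

theorem SameBComponent.trans (h : H.SameBComponent x y) (h' : H.SameBComponent y z) :
    H.SameBComponent x z := SimpleGraph.Reachable.trans h h'

theorem sameBComponent_of_und (h : H.und x y) : H.SameBComponent x y :=
  SimpleGraph.Adj.reachable (G := H.undirectedSubgraph) h

theorem sameBComponent_iff : H.SameBComponent x y ↔ ReflTransGen H.und x y :=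
  SimpleGraph.reachable_iff_reflTransGen _ _

theorem sameBComponent_of_mem_supp {C : H.BComponent} (hx : x ∈ C.supp) (hy : y ∈ C.supp) :
    H.SameBComponent x y :=
  SimpleGraph.ConnectedComponent.exact (hx.trans hy.symm)

namespace ClosedUnderMeek

/-- At each undirected edge, rule 1 gives adjacency, rule 2 excludes the reverse arrow, and an
undirected edge would put `z` in the component. -/
theorem dir_of_und (hM : H.ClosedUnderMeek) (hz : ¬ H.SameBComponent z x)
    (hxy : H.SameBComponent x y) (hd : H.dir z x) : H.dir z y := by
  rw [sameBComponent_iff] at hxy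
  induction hxy with
  | refl => exact hd
  | @tail u w hu huw ih =>
    rw [← sameBComponent_iff] at hu
    rcases hM.rule1 _ _ _ ih huw with h | h | h
    · exact h
    · exact (hM.rule2 _ _ _ h ih (H.und_symm _ _ huw)).elim
    · exact (hz ((sameBComponent_of_und h).trans
        ((sameBComponent_of_und (H.und_symm _ _ huw)).trans hu.symm))).elim

theorem pa_chainSkeleton_subset (hM : H.ClosedUnderMeek) (h : H.SameBComponent x y) :
    H.chainSkeleton.pa x ⊆ H.chainSkeleton.pa y :=
  fun _ hz => ⟨hM.dir_of_und hz.2 h hz.1, fun h' => hz.2 (h'.trans h.symm)⟩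

/-- If `x → u - w`, then `x → w` or `x - w`. -/
theorem dir_or_und (hM : H.ClosedUnderMeek) {u w : V} (hxu : H.dir x u) (huw : H.und u w) :
    H.dir x w ∨ H.und x w := by
  rcases hM.rule1 _ _ _ hxu huw with h | h | h
  · exact Or.inl h
  · exact (hM.rule2 _ _ _ h hxu (H.und_symm _ _ huw)).elim
  · exact Or.inr h

/-- Induction along an undirected path from `y` to `x`. At its first edge `u - w`, either `x → w`
and the induction hypothesis applies, or `x - w`, and rules 1 and 4 make `z` and `u` adjacent. Rule
2 and acyclicity then fix the direction. -/
theorem dir_trans (hM : H.ClosedUnderMeek) (hac : H.Acyclic) (hzx : H.dir z x) (hxy : H.dir x y)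
    (h : H.SameBComponent y x) : H.dir z y := by
  rw [sameBComponent_iff] at h
  revert hxy
  induction h using ReflTransGen.head_induction_on with
  | refl => exact fun h => (H.dir_asymm _ _ h h).elim
  | @head u w huw _ ih =>
    intro hxu
    have hadj : H.skeleton.Adj z u := by
      rcases hM.dir_or_und hxu huw with hxw | hxw
      · exact hM.rule1 _ _ _ (ih hxw) (H.und_symm _ _ huw)
      · rcases hM.dir_or_und hzx hxw with hzw | hzw
        · exact hM.rule1 _ _ _ hzw (H.und_symm _ _ huw)
        · by_contra hn
          exact hM.rule4 w u z x (H.und_symm _ _ hzw) hzx hxu (Or.inr (Or.inr (H.und_symm _ _ hxw)))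
            hn (H.und_symm _ _ huw)
    rcases hadj with h | h | h
    · exact h
    · exact (hac z (.tail (.tail (.single hzx) hxu) h)).elim
    · exact (hM.rule2 _ _ _ hzx hxu h).elim

/-- The collider moves along the undirected path to `x` until one of its two edges becomes
undirected, where rule 1 applies; if both do at once, rule 3 applies. -/
theorem adj_of_collider (hM : H.ClosedUnderMeek) (hzy : H.dir z y) (hxy : H.dir x y) (hne : z ≠ x)
    (h : H.SameBComponent y x) : H.skeleton.Adj x z := by
  by_contra hn
  rw [sameBComponent_iff] at h
  revert hxy hzy
  induction h using ReflTransGen.head_induction_on with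
  | refl => exact fun _ h => (H.dir_asymm _ _ h h).elim
  | @head u w huw _ ih =>
    intro hzu hxu
    rcases hM.dir_or_und hxu huw with hxw | hxw <;> rcases hM.dir_or_und hzu huw with hzw | hzw
    · exact ih hzw hxw
    · exact hn (hM.rule1 _ _ _ hxw (H.und_symm _ _ hzw))
    · exact hn (hM.rule1 _ _ _ hzw (H.und_symm _ _ hxw)).symm
    · exact hM.rule3 w u z x (H.und_symm _ _ hzw) (H.und_symm _ _ hxw) hzu hxu hne
        (fun h => hn h.symm) (H.und_symm _ _ huw)

theorem adj_of_dir (hM : H.ClosedUnderMeek) (hac : H.Acyclic) (hxy : H.dir x y)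
    (h : H.SameBComponent y x) (hyz : H.skeleton.Adj y z) (hz : H.SameBComponent y z)
    (hne : z ≠ x) : H.skeleton.Adj x z := by
  rcases hyz with hd | hd | hd
  · exact (hM.dir_trans hac hxy hd hz.symm).adj
  · exact hM.adj_of_collider hd hxy hne h
  · exact hM.rule1 _ _ _ hxy hd

/-- Since outside parents are shared by a component, after a directed edge every later component on
the cycle is reached from `c i` by directed paths in `H`, finally that of `c i` itself. -/
theorem chainSkeleton_isChainGraph (hM : H.ClosedUnderMeek) (hac : H.Acyclic) :
    H.chainSkeleton.IsChainGraph := by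
  rintro n c ⟨-, hc⟩ i
  refine (hc i).resolve_left fun hi => ?_
  have key : ∀ k : ℕ, ∀ w, H.SameBComponent (c (i + 1 + Fin.ofNat (n + 3) k)) w →
      TransGen H.dir (c i) w := by
    intro k
    induction k with
    | zero =>
      intro w hw
      rw [show i + 1 + Fin.ofNat (n + 3) 0 = i + 1 from by ext; simp [Fin.val_add]] at hw
      exact .single (hM.dir_of_und hi.2 hw hi.1)
    | succ k ih =>
      intro w hw
      have hk := hc (i + 1 + Fin.ofNat (n + 3) k)
      rw [add_assoc (i + 1), Fin.ofNat_add_one] at hk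
      rcases hk with hk | hk | hk
      · exact (ih _ (.refl _)).tail (hM.dir_of_und hk.2 hw hk.1)
      · exact ih _ ((sameBComponent_of_und hk).trans hw)
      · exact ih _ (hk.2.trans hw)
  refine hac (c i) (key (n + 2) (c i) ?_)
  rw [show i + 1 + Fin.ofNat (n + 3) (n + 2) = i from ?_]
  · exact .refl _
  · rw [add_assoc, add_comm 1, Fin.ofNat_add_one]
    ext
    simp

end ClosedUnderMeek

theorem IsDAG.exists_collider [Finite V] {D : PDGraph V} (hD : D.IsDAG) {n : ℕ}
    {c : Fin (n + 4) → V} (hc : ∀ i, D.skeleton.Adj (c i) (c (i + 1))) :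
    ∃ i, D.dir (c i) (c (i + 1)) ∧ D.dir (c (i + 1 + 1)) (c (i + 1)) := by
  obtain ⟨f, hf⟩ := hD.acyclic.exists_rank
  -- A vertex of maximal rank on the cycle is a collider.
  obtain ⟨j, -, hj⟩ := Finset.exists_max_image Finset.univ (fun i => f (c i)) ⟨0, by simp⟩
  refine ⟨j - 1, ?_⟩
  rw [sub_add_cancel]
  have h1 := hc (j - 1)
  rw [sub_add_cancel] at h1
  exact ⟨(hD.dir_or_dir h1).resolve_right fun h => (hf _ _ h).not_ge (hj _ (by simp)),
    (hD.dir_or_dir (hc j)).resolve_left fun h => (hf _ _ h).not_ge (hj _ (by simp))⟩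

/-- If some DAG has the skeleton and v-structures of `H`, and no B-component of `H` contains a
v-structure, then the B-components of `H` are chordal. -/
theorem IsDAG.isChordalGraph_bComponent [Finite V] {D : PDGraph V} (hD : D.IsDAG)
    (hsk : H.skeleton = D.skeleton) (hv : H.vStructures = D.vStructures) (C : H.BComponent)
    (hC : ∀ a b c, a ∈ C.supp → b ∈ C.supp → H.dir a b → H.dir c b → a ≠ c →
      H.skeleton.Adj a c) : C.graph.skeleton.IsChordalGraph := by
  intro n c hinj hc
  obtain ⟨i, h1, h2⟩ := hD.exists_collider (c := fun i => (c i : V)) fun i => hsk ▸ hc i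
  have hs1 := Fin.val_add_one_eq_ite i
  have hs2 := Fin.val_add_one_eq_ite (i + 1)
  have hs3 := Fin.val_add_one_eq_ite (i + 1 + 1)
  have hne : i ≠ i + 1 + 1 := fun h => by grind
  refine ⟨i, i + 1 + 1, fun h => by grind, fun h => by grind, ?_⟩
  change H.skeleton.Adj (c i) (c (i + 1 + 1))
  have hne' : (c i : V) ≠ c (i + 1 + 1) := fun h => hne (hinj (Subtype.ext h))
  by_contra hn
  have hmem : ((c i : V), (c (i + 1) : V), (c (i + 1 + 1) : V)) ∈ H.vStructures :=
    hv ▸ ⟨h1, h2, hne', hsk ▸ hn⟩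
  exact hn (hC _ _ _ (c i).2 (c (i + 1)).2 hmem.1 hmem.2.1 hne')

/-! ### CPDAGs -/

/-- Equivalent DAGs share their v-structures, so the edges of these are directed in the CPDAG. -/
theorem IsCPDAGOf.vStructures_eq {C D : PDGraph V} (h : C.IsCPDAGOf D) (hD : D.IsDAG) :
    C.vStructures = D.vStructures := by
  obtain ⟨-, hsk, hdir⟩ := h
  have hCD : ∀ a b, C.dir a b → D.dir a b := fun a b h =>
    (hdir a b).1 h D hD fun _ _ _ _ _ _ => Iff.rfl
  refine Set.Subset.antisymm ?_ ?_
  · rintro ⟨a, b, c⟩ ⟨h1, h2, h3, h4⟩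
    exact ⟨hCD _ _ h1, hCD _ _ h2, h3, hsk ▸ h4⟩
  · rintro ⟨a, b, c⟩ ht
    refine ⟨(hdir _ _).2 fun D' hD' h => ?_, (hdir _ _).2 fun D' hD' h => ?_, ht.2.2.1,
      hsk ▸ ht.2.2.2⟩
    · exact (h.vStructures_subset hD hD' ht).1
    · exact (h.vStructures_subset hD hD' ht).2.1

/-- The CPDAG of a DAG. -/
def cpdag (D : PDGraph V) : PDGraph V where
  -- The first conjunct makes `dir_asymm` hold for arbitrary `D`; for a DAG it follows from the
  -- second.
  dir x y := D.dir x y ∧ ∀ D' : PDGraph V, D'.IsDAG → MarkovEquivalent D D' → D'.dir x y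
  und x y := D.skeleton.Adj x y ∧
    ¬ (∀ D' : PDGraph V, D'.IsDAG → MarkovEquivalent D D' → D'.dir x y) ∧
    ¬ (∀ D' : PDGraph V, D'.IsDAG → MarkovEquivalent D D' → D'.dir y x)
  und_symm _ _ h := ⟨h.1.symm, h.2.2, h.2.1⟩
  und_irrefl _ h := h.1.ne rfl
  dir_asymm _ _ h h' := D.dir_asymm _ _ h.1 h'.1
  dir_not_und _ _ h h' := h'.2.1 h.2

theorem IsDAG.cpdag_isCPDAGOf {D : PDGraph V} (hD : D.IsDAG) : D.cpdag.IsCPDAGOf D := by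
  have hself : ∀ {a b}, (∀ D' : PDGraph V, D'.IsDAG → MarkovEquivalent D D' → D'.dir a b) →
      D.dir a b := fun h => h D hD fun _ _ _ _ _ _ => Iff.rfl
  refine ⟨fun n c hc => hD.2 n c ⟨hc.1, fun i => (hc.2 i).1⟩, ?_, fun x y =>
    ⟨fun h => h.2, fun h => ⟨hself h, h⟩⟩⟩
  ext a b
  constructor
  · rintro (h | h | h)
    · exact h.1.adj
    · exact h.1.adj'
    · exact h.1
  · intro h
    by_cases h1 : ∀ D' : PDGraph V, D'.IsDAG → MarkovEquivalent D D' → D'.dir a b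
    · exact Or.inl ⟨hself h1, h1⟩
    by_cases h2 : ∀ D' : PDGraph V, D'.IsDAG → MarkovEquivalent D D' → D'.dir b a
    · exact Or.inr (Or.inl ⟨hself h2, h2⟩)
    · exact Or.inr (Or.inr ⟨h, h1, h2⟩)

theorem IsCPDAGOf.of_markovEquivalent {C D D' : PDGraph V} (h : C.IsCPDAGOf D) (hD : D.IsDAG)
    (hD' : D'.IsDAG) (he : MarkovEquivalent D D') : C.IsCPDAGOf D' := by
  refine ⟨h.1, h.2.1.trans (he.skeleton_eq hD hD'), fun x y => (h.2.2 x y).trans ?_⟩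
  exact forall_congr' fun D'' => forall_congr' fun _ =>
    ⟨fun h h' => h (he.trans h'), fun h h' => h (he.symm.trans h')⟩

/-! ### The characterization -/

theorem IsCausalMPDAG.conditions [Finite V] (h : H.IsCausalMPDAG) :
    H.chainSkeleton.IsChainGraph ∧
      (∀ C : H.BComponent, C.graph.skeleton.IsChordalGraph) ∧
      (∀ C : H.BComponent, ∀ x ∈ C.supp, ∀ y ∈ C.supp,
        H.chainSkeleton.pa x = H.chainSkeleton.pa y) ∧
      (∀ C : H.BComponent, ∀ x y : C.supp, C.graph.dir x y →
        H.pa x ⊆ H.pa y \ {(x : V)} ∧ C.graph.adj y \ {x} ⊆ C.graph.adj x) := by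
  obtain ⟨⟨hP, hM⟩, C, B, -, ⟨D, ⟨hD, hCD⟩, -⟩, hsk, hv, -⟩ := h
  have hac := hP.acyclic
  refine ⟨hM.chainSkeleton_isChainGraph hac, fun K => ?_, fun K x hx y hy => ?_,
    fun K x y hd => ⟨fun z hz => ⟨?_, ?_⟩, fun z hz => ?_⟩⟩
  · refine hD.isChordalGraph_bComponent (hsk.trans hCD.2.1) (hv.trans (hCD.vStructures_eq hD)) K ?_
    exact fun a b c ha hb hab hcb hne =>
      hM.adj_of_collider hcb hab hne.symm (sameBComponent_of_mem_supp hb ha)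
  · have h := sameBComponent_of_mem_supp hx hy
    exact (hM.pa_chainSkeleton_subset h).antisymm (hM.pa_chainSkeleton_subset h.symm)
  · exact hM.dir_trans hac hz hd (sameBComponent_of_mem_supp y.2 x.2)
  · rintro rfl
    exact H.dir_asymm _ _ hz hz
  · exact hM.adj_of_dir hac hd (sameBComponent_of_mem_supp y.2 x.2) hz.1
      (sameBComponent_of_mem_supp y.2 z.2) fun h => hz.2 (Subtype.ext h)

/-- The four conditions of the characterization of causal MPDAGs, in terms of the vertices. -/
structure Conditions (H : PDGraph V) : Prop where
  chain : H.chainSkeleton.IsChainGraph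
  chordal : H.chainSkeleton.undirectedSubgraph.IsChordalGraph
  dir_of_sameBComponent : ∀ z x y, H.dir z x → ¬ H.SameBComponent z x → H.SameBComponent x y →
    H.dir z y
  dir_trans : ∀ z x y, H.dir z x → H.dir x y → H.SameBComponent x y → H.dir z y
  adj_of_dir : ∀ x y z, H.dir x y → H.SameBComponent x y → H.skeleton.Adj y z →
    H.SameBComponent y z → z ≠ x → H.skeleton.Adj x z

theorem chainSkeleton_und_iff :
    H.chainSkeleton.und x y ↔ H.skeleton.Adj x y ∧ H.SameBComponent x y := by
  constructor
  · rintro (h | ⟨h | h, hs⟩)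
    · exact ⟨Or.inr (Or.inr h), sameBComponent_of_und h⟩
    · exact ⟨Or.inl h, hs⟩
    · exact ⟨Or.inr (Or.inl h), hs⟩
  · rintro ⟨h | h | h, hs⟩
    · exact Or.inr ⟨Or.inl h, hs⟩
    · exact Or.inr ⟨Or.inr h, hs⟩
    · exact Or.inl h

/-- A cycle of undirected edges of the chain skeleton stays in one B-component, so chordality of the
components suffices. -/
theorem Conditions.of_bComponents (h1 : H.chainSkeleton.IsChainGraph)
    (h2 : ∀ C : H.BComponent, C.graph.skeleton.IsChordalGraph)
    (h3 : ∀ C : H.BComponent, ∀ x ∈ C.supp, ∀ y ∈ C.supp,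
      H.chainSkeleton.pa x = H.chainSkeleton.pa y)
    (h4 : ∀ C : H.BComponent, ∀ x y : C.supp, C.graph.dir x y →
      H.pa x ⊆ H.pa y \ {(x : V)} ∧ C.graph.adj y \ {x} ⊆ C.graph.adj x) : H.Conditions := by
  have hmem : ∀ {x y}, H.SameBComponent x y →
      y ∈ (H.undirectedSubgraph.connectedComponentMk x).supp :=
    fun h => SimpleGraph.ConnectedComponent.sound h.symm
  refine ⟨h1, ?_, ?_, ?_, ?_⟩
  · intro n c hinj hc
    set C : H.BComponent := H.undirectedSubgraph.connectedComponentMk (c 0) with hCdef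
    have hC : ∀ k : ℕ, H.SameBComponent (c 0) (c (Fin.ofNat (n + 4) k)) := by
      intro k
      induction k with
      | zero => exact .refl _
      | succ k ih =>
        have := hc (Fin.ofNat (n + 4) k)
        rw [Fin.ofNat_add_one] at this
        exact ih.trans (chainSkeleton_und_iff.1 this).2
    have hC' : ∀ i, c i ∈ C.supp := by
      intro i
      have := hC i.1
      rw [show Fin.ofNat (n + 4) i.1 = i from Fin.ext (Nat.mod_eq_of_lt i.2)] at this
      exact hmem this
    obtain ⟨i, j, hij, hji, hadj⟩ := h2 C n (fun i => ⟨c i, hC' i⟩)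
      (fun i j h => hinj (congrArg Subtype.val h)) fun i => (chainSkeleton_und_iff.1 (hc i)).1
    exact ⟨i, j, hij, hji,
      chainSkeleton_und_iff.2 ⟨hadj, sameBComponent_of_mem_supp (hC' i) (hC' j)⟩⟩
  · intro z x y hzx hn hxy
    have : z ∈ H.chainSkeleton.pa y := h3 _ x (hmem (.refl x)) y (hmem hxy) ▸ ⟨hzx, hn⟩
    exact this.1
  · intro z x y hzx hxy hs
    exact ((h4 _ ⟨x, hmem (.refl x)⟩ ⟨y, hmem hs⟩ hxy).1 hzx).1
  · intro x y z hxy hs hyz hs' hne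
    exact (h4 _ ⟨x, hmem (.refl x)⟩ ⟨y, hmem hs⟩ hxy).2
      (show (⟨z, hmem (hs.trans hs')⟩ : (H.undirectedSubgraph.connectedComponentMk x).supp) ∈ _ from
        ⟨hyz, fun h => hne (congrArg Subtype.val h)⟩)

/-! ### Sufficiency: extensions of `H` to DAGs -/

namespace Conditions

/-- The orientation of `H` that keeps the directed edges between B-components and orients the
other edges by `f`. -/
def orient (H : PDGraph V) (f : V → ℕ) : PDGraph V where
  dir x y := H.chainSkeleton.dir x y ∨ (H.chainSkeleton.und x y ∧ f x < f y)
  und _ _ := False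
  und_symm _ _ h := h
  und_irrefl _ h := h
  dir_asymm := by
    rintro x y (h | h) (h' | h')
    · exact H.chainSkeleton.dir_asymm _ _ h h'
    · exact H.chainSkeleton.dir_not_und _ _ h (H.chainSkeleton.und_symm _ _ h'.1)
    · exact H.chainSkeleton.dir_not_und _ _ h' (H.chainSkeleton.und_symm _ _ h.1)
    · exact lt_asymm h.2 h'.2
  dir_not_und _ _ _ h := h

/-- By the chain graph condition a directed cycle would be undirected in the chain skeleton, and `f`
would increase all the way round. -/
theorem orient_isDAG (h : H.Conditions) (f : V → ℕ) : (orient H f).IsDAG := by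
  refine ⟨fun _ _ h => h, fun n c hc => ?_⟩
  have hund := h.chain n c ⟨hc.1, fun i => (hc.2 i).imp id And.left⟩
  have hlt : ∀ i, f (c i) < f (c (i + 1)) := fun i =>
    ((hc.2 i).resolve_left fun hd => H.chainSkeleton.dir_not_und _ _ hd (hund i)).2
  obtain ⟨j, -, hj⟩ := Finset.exists_max_image Finset.univ (fun i => f (c i)) ⟨0, by simp⟩
  exact (hlt j).not_ge (hj _ (by simp))

/-- A directed cycle stays in one component, where composing arrows makes `c 0` a parent of itself.
-/
theorem acyclic (h : H.Conditions) : H.Acyclic := by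
  refine IsPDAG.acyclic fun n c hc => ?_
  have hund := h.chain n c ⟨hc.1, fun i => ?_⟩
  · have key : ∀ k : ℕ, H.dir (c 0) (c (Fin.ofNat (n + 3) k + 1)) := by
      intro k
      induction k with
      | zero => exact hc.2 0
      | succ k ih =>
        rw [Fin.ofNat_add_one] at ih
        exact h.dir_trans _ _ _ ih (hc.2 _) (chainSkeleton_und_iff.1 (hund _)).2
    have := key (n + 2)
    rw [Fin.ofNat_add_one, show Fin.ofNat (n + 3) (n + 2 + 1) = 0 from Fin.ext (by simp)] at this
    exact H.dir_asymm _ _ this this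
  · by_cases hs : H.SameBComponent (c i) (c (i + 1))
    · exact Or.inr (Or.inr ⟨Or.inl (hc.2 i), hs⟩)
    · exact Or.inl ⟨hc.2 i, hs⟩

theorem sameBComponent_of_dir_dir (h : H.Conditions) {z₁ z₂ y : V} (h1 : H.dir z₁ z₂)
    (h2 : H.dir z₂ y) (hs : H.SameBComponent z₁ y) : H.SameBComponent z₂ y := by
  by_contra hn
  have hn' : ¬ H.SameBComponent z₁ z₂ := fun h' => hn (h'.symm.trans hs)
  exact H.dir_asymm _ _ h1 (h.dir_of_sameBComponent _ _ _ h2 hn hs.symm)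

theorem closedUnderMeek (h : H.Conditions) : H.ClosedUnderMeek := by
  constructor
  · intro x y z hxy hyz
    by_cases hs : H.SameBComponent x y
    · refine h.adj_of_dir x y z hxy hs (Or.inr (Or.inr hyz)) (sameBComponent_of_und hyz) ?_
      rintro rfl
      exact H.dir_not_und _ _ hxy (H.und_symm _ _ hyz)
    · exact (h.dir_of_sameBComponent x y z hxy hs (sameBComponent_of_und hyz)).adj
  · intro x y z hxy hyz hxz
    have hs := h.sameBComponent_of_dir_dir hxy hyz (sameBComponent_of_und hxz)
    exact H.dir_not_und _ _ (h.dir_trans _ _ _ hxy hyz hs) hxz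
  · intro x y z₁ z₂ h1 h2 h3 h4 hne hn hxy
    have hs1 : H.SameBComponent z₁ y :=
      (sameBComponent_of_und h1).symm.trans (sameBComponent_of_und hxy)
    have hs2 : H.SameBComponent z₂ y :=
      (sameBComponent_of_und h2).symm.trans (sameBComponent_of_und hxy)
    exact hn (h.adj_of_dir z₁ y z₂ h3 hs1 h4.adj' hs2.symm hne.symm)
  · intro x y z₁ z₂ h1 h2 h3 _ hn hxy
    have hs : H.SameBComponent z₁ y :=
      (sameBComponent_of_und h1).symm.trans (sameBComponent_of_und hxy)
    exact hn (h.dir_trans _ _ _ h2 h3 (h.sameBComponent_of_dir_dir h2 h3 hs)).adj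

/-- A DAG extension of `H` with the same v-structures in which all undirected edges of `H` at a
given vertex point away from it. -/
theorem exists_extension [Finite V] (h : H.Conditions) (x : V) :
    ∃ D : PDGraph V, D.IsDAG ∧ D.skeleton = H.skeleton ∧ D.vStructures = H.vStructures ∧
      (∀ a b, H.dir a b → D.dir a b) ∧ ∀ y, H.und x y → D.dir x y := by
  classical
  have := Fintype.ofFinite V
  set R : V → V → Prop := fun a b => H.dir a b ∧ H.SameBComponent a b with hRdef
  have hRR : ∀ a b, R a b → H.chainSkeleton.undirectedSubgraph.Adj a b ∧ ∀ c, c ≠ a →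
      H.chainSkeleton.undirectedSubgraph.Adj b c → H.chainSkeleton.undirectedSubgraph.Adj a c := by
    rintro a b ⟨hab, hs⟩
    refine ⟨chainSkeleton_und_iff.2 ⟨hab.adj, hs⟩, fun c hca hbc => ?_⟩
    obtain ⟨hbc, hs'⟩ := chainSkeleton_und_iff.1 hbc
    exact chainSkeleton_und_iff.2 ⟨h.adj_of_dir a b c hab hs hbc hs' hca, hs.trans hs'⟩
  have htrans : ∀ a b c, R a b → R b c → R a c := fun a b c hab hbc =>
    ⟨h.dir_trans _ _ _ hab.1 hbc.1 hbc.2, hab.2.trans hbc.2⟩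
  -- The initial clique consists of `x` and its parents in its component, so the undirected
  -- neighbours of `x` come after it.
  obtain ⟨f, hf1, hf2, hf3, hf4⟩ := h.chordal.exists_elimination (R := R)
    (fun a ha => H.dir_asymm _ _ ha.1 ha.1) htrans hRR Finset.univ
    (Finset.univ.filter fun a => a = x ∨ R a x) (Finset.subset_univ _) (by
      simp only [Finset.coe_filter, Finset.mem_univ, true_and]
      rintro a (rfl | ha) b (rfl | hb) hne
      · exact (hne rfl).elim
      · exact (hRR _ _ hb).1.symm
      · exact (hRR _ _ ha).1
      · exact (hRR _ _ ha).2 b hne.symm (hRR _ _ hb).1.symm) (by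
      simp only [Finset.mem_filter, Finset.mem_univ, true_and]
      rintro q (rfl | hq) v - hv
      · exact Or.inr hv
      · exact Or.inr (htrans _ _ _ hv hq))
  simp only [Finset.mem_univ, true_and, forall_true_left, Finset.mem_filter] at hf1 hf2 hf3 hf4
  have hdir : ∀ a b, H.dir a b → (orient H f).dir a b := by
    intro a b hab
    by_cases hs : H.SameBComponent a b
    · exact Or.inr ⟨chainSkeleton_und_iff.2 ⟨hab.adj, hs⟩, hf2 a b ⟨hab, hs⟩⟩
    · exact Or.inl ⟨hab, hs⟩
  have hsk : (orient H f).skeleton = H.skeleton := by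
    ext a b
    constructor
    · rintro ((hd | hd) | (hd | hd) | hd)
      · exact hd.1.adj
      · exact (chainSkeleton_und_iff.1 hd.1).1
      · exact hd.1.adj'
      · exact (chainSkeleton_und_iff.1 hd.1).1.symm
      · exact hd.elim
    · rintro (hd | hd | hd)
      · exact (hdir _ _ hd).adj
      · exact (hdir _ _ hd).adj'
      · rcases lt_trichotomy (f a) (f b) with hlt | heq | hlt
        · exact Or.inl (Or.inr ⟨Or.inl hd, hlt⟩)
        · exact (H.undirectedSubgraph.irrefl (hf1 a b heq ▸ hd)).elim
        · exact Or.inr (Or.inl (Or.inr ⟨Or.inl (H.und_symm _ _ hd), hlt⟩))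
  refine ⟨orient H f, h.orient_isDAG f, hsk, ?_, hdir, ?_⟩
  · have key : ∀ a b c, (orient H f).dir a b → (orient H f).dir c b → a ≠ c →
        ¬ H.skeleton.Adj a c → H.dir a b := by
      intro a b c ha hc hne hn
      rcases ha with ha | ha
      · exact ha.1
      · rcases hc with hc | hc
        · exact (hn (h.dir_of_sameBComponent _ _ _ hc.1 hc.2
            (chainSkeleton_und_iff.1 ha.1).2.symm).adj').elim
        · exact (hn (chainSkeleton_und_iff.1 (hf3 b a c ha.2 hc.2
            (H.chainSkeleton.und_symm _ _ ha.1) (H.chainSkeleton.und_symm _ _ hc.1) hne)).1).elim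
    refine Set.Subset.antisymm ?_ ?_
    · rintro ⟨a, b, c⟩ ⟨h1, h2, h3, h4⟩
      dsimp only at h1 h2 h3 h4
      rw [hsk] at h4
      exact ⟨key _ _ _ h1 h2 h3 h4, key _ _ _ h2 h1 h3.symm fun h => h4 h.symm, h3, h4⟩
    · rintro ⟨a, b, c⟩ ⟨h1, h2, h3, h4⟩
      exact ⟨hdir _ _ h1, hdir _ _ h2, h3, hsk ▸ h4⟩
  · intro y hxy
    refine Or.inr ⟨Or.inl hxy, hf4 x (Or.inl rfl) y ?_⟩
    rintro (rfl | hy)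
    · exact H.und_irrefl _ hxy
    · exact H.dir_not_und _ _ hy.1 (H.und_symm _ _ hxy)

theorem isCausalMPDAG [Finite V] (h : H.Conditions) : H.IsCausalMPDAG := by
  refine ⟨⟨h.acyclic.isPDAG, h.closedUnderMeek⟩, ?_⟩
  rcases isEmpty_or_nonempty V with hV | ⟨⟨x₀⟩⟩
  · have hH : H.IsDAG := ⟨fun x => hV.elim x, h.acyclic.isPDAG⟩
    refine ⟨H.cpdag, ∅, ⟨H, hH, hH.cpdag_isCPDAGOf⟩, ⟨H, ⟨hH, hH.cpdag_isCPDAGOf⟩, by simp⟩,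
      hH.cpdag_isCPDAGOf.2.1.symm, (hH.cpdag_isCPDAGOf.vStructures_eq hH).symm,
      fun x => hV.elim x⟩
  obtain ⟨D, hD, hsk, hv, hdir, -⟩ := h.exists_extension x₀
  have hC := hD.cpdag_isCPDAGOf
  -- The constraints demand exactly the arrows of `H`.
  refine ⟨D.cpdag, {b | ∃ x y, H.dir x y ∧ b = .direct x y}, ⟨D, hD, hC⟩, ⟨D, ⟨hD, hC⟩, ?_⟩,
    hsk.symm.trans hC.2.1.symm, hv.symm.trans (hC.vStructures_eq hD).symm, fun x y => ⟨?_, ?_⟩⟩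
  · rintro _ ⟨x, y, hxy, rfl⟩
    exact hdir _ _ hxy
  · exact fun hxy D' hD' => hD'.2 _ ⟨x, y, hxy, rfl⟩
  · intro hall
    -- The extension is taken at the head `y`, so that an undirected edge `x - y` would be oriented
    -- `y → x`.
    obtain ⟨D', hD', hsk', hv', hdir', hund⟩ := h.exists_extension y
    have he := markovEquivalent_of_skeleton_eq hD hD' (hsk.trans hsk'.symm) (hv.trans hv'.symm)
    have hxy : D'.dir x y := by
      refine hall D' ⟨⟨hD', hC.of_markovEquivalent hD hD' he⟩, ?_⟩
      rintro _ ⟨a, b, hab, rfl⟩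
      exact hdir' _ _ hab
    have hadj : H.skeleton.Adj x y := hsk' ▸ hxy.adj
    rcases hadj with hd | hd | hd
    · exact hd
    · exact (D'.dir_asymm _ _ hxy (hdir' _ _ hd)).elim
    · exact (D'.dir_asymm _ _ hxy (hund _ (H.und_symm _ _ hd))).elim

end Conditions

end PDGraph

theorem mainTheorem3 {V : Type*} [Finite V] (H : PDGraph V) :
    H.IsCausalMPDAG ↔
      H.chainSkeleton.IsChainGraph ∧
      (∀ C : H.BComponent, C.graph.skeleton.IsChordalGraph) ∧
      (∀ C : H.BComponent, ∀ x ∈ C.supp, ∀ y ∈ C.supp,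
        H.chainSkeleton.pa x = H.chainSkeleton.pa y) ∧
      (∀ C : H.BComponent, ∀ x y : C.supp, C.graph.dir x y →
        H.pa x ⊆ H.pa y \ {(x : V)} ∧ C.graph.adj y \ {x} ⊆ C.graph.adj x) :=
  ⟨PDGraph.IsCausalMPDAG.conditions, fun ⟨h1, h2, h3, h4⟩ =>
    (PDGraph.Conditions.of_bComponents h1 h2 h3 h4).isCausalMPDAG⟩
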